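/- **Setting.** A Stackelberg security game with $n\ge 1$ targets $\mathcal Y=\{1,\dots,n\}$ consists of a non-empty closed convex set $\mathcal X\subseteq[0,1]^n$ that is downward closed ($x\in\mathcal X$ and $0\le x'\le x$ entrywise imply $x'\in\mathcal X$) and, for each $y\in\mathcal Y$, of continuous functions $u^y,v^y:[0,1]\to[0,1]$ with $u^y$ strictly increasing and $v^y$ strictly decreasing. For $x\in\mathcal X$ put $\mathrm{BR}(x)=\arg\max_{y} v^y(x_y)$; the principal's value of $x$ is $\max_{y\in \mathrm{BR}(x)}u^y(x_y)$. Call $x$ *conservative* if $x_y>0$ only for $y\in \mathrm{BR}(x)$. The best response region of $y$ is $K_y=\{x\in\mathcal X: y\in \mathrm{BR}(x)\}$. **Bit precision assumption**, for an integer $L\ge1$: every $v^y$ is of the form $v^y(t)=d_y-c_yt$ with $c_y,d_y$ rational with denominators at most $2^L$; every non-empty $K_y$ has $n$-dimensional volume at least $2^{-nL}$; and $\mathcal X=\{x\in[0,1]^n : a_i^{\top}x\le b_i,\ i=1,\dots,m\}$ for some $m$, where the $b_i$ and all entries of the $a_i$ are rational with numerators (in absolute value) and denominators at most $2^L$. **Oracle.**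 Each query is a point $x\in\mathcal X$ and is answered by an arbitrary element of $\mathrm{BR}(x)$ (ties may be broken differently, also adaptively, at every query). **Algorithm** $\textsc{Clinch}$ with accuracy $\delta$ and slope bound $C$, exact oracle and trivial initial bounds. Let $\lambda=\delta/(4C^2)$, $\underline x=\mathbf 0$, $\overline x=\mathbf 1$, $S=\mathcal X$, $\mathcal R=\mathcal Y$, $y=1$. While $y\in\mathcal R$: for each $y'$ with $\underline x+\lambda\mathbf e_{y'}\notin S$ remove $y'$ from $\mathcal R$ and set $\overline x_{y'}\gets\underline x_{y'}$; then set $S\gets\{x'\in\mathcal X:\underline x\le x'\le\overline x\}$; let $x$ be the centroid of $S$ (mean of the uniform distribution on $S$, with respect to the dimension of $S$); let $y$ be the oracle's answer to $x$; set $\underline x_y\gets x_y$. After the loop, for each $y\in\mathcal Y$ do a binary search: start with $\ell=\underline x_y$, $r=x_y$; while $r-\ell\ge\lambda$, let $m=(\ell+r)/2$, query $x+(m-x_y)\mathbf e_y$, and set $\ell\gets m$ if the answer is $y$, $r\gets m$ otherwise; finally $\hat x_y=\ell$. Return $\hat x$. **Proposition.** There is a universal constant $K$ such that the following holds for all $n\ge1$,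 $L\ge1$ and every game satisfying the bit precision assumption with parameter $L$. There is exactly one conservative strategy $x^\star$ that maximizes the principal's value over $\mathcal X$. For every best response oracle, $\textsc{Clinch}$ with $C=2^L$ and $\delta=\tfrac13 2^{-8Ln}$ terminates after at most $K n^2L$ queries and returns $\hat x\in\mathcal X$ with $\|\hat x-x^\star\|_\infty\le\delta$, and rounding $\hat x$ gives $x^\star$ exactly: for every $y$, the number $x^\star_y$ is the unique rational with denominator at most $2^{4Ln}$ that is nearest to $\hat x_y$. For those $y$ for which $x^\star_y$ is an integer multiple of $2^{-8Ln}$, it is also the unique multiple of $2^{-8Ln}$ nearest to $\hat x_y$. -/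

import Mathlib

open MeasureTheory

noncomputable section

/-- A Stackelberg security game with targets `Fin n`. The strategy set `X ⊆ [0,1]^n` is non-empty,
closed, convex and downward closed; covering target `y` with probability `t` gives the principal
`u y t` and the agent `v y t` when `y` is attacked. Only the values of `u y`, `v y` on `[0,1]`
matter. -/
structure SecurityGame (n : ℕ) where
  X : Set (Fin n → ℝ)
  u : Fin n → ℝ → ℝ
  v : Fin n → ℝ → ℝ
  nonempty : X.Nonempty
  subset_cube : X ⊆ Set.Icc 0 1
  isClosed : IsClosed X
  convex : Convex ℝ X
  downward_closed : ∀ x ∈ X, ∀ x' : Fin n → ℝ, 0 ≤ x' → x' ≤ x → x' ∈ X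
  u_continuous : ∀ y, ContinuousOn (u y) (Set.Icc 0 1)
  u_strictMono : ∀ y, StrictMonoOn (u y) (Set.Icc 0 1)
  u_mapsTo : ∀ y, Set.MapsTo (u y) (Set.Icc 0 1) (Set.Icc 0 1)
  v_continuous : ∀ y, ContinuousOn (v y) (Set.Icc 0 1)
  v_strictAnti : ∀ y, StrictAntiOn (v y) (Set.Icc 0 1)
  v_mapsTo : ∀ y, Set.MapsTo (v y) (Set.Icc 0 1) (Set.Icc 0 1)

namespace SecurityGame

variable {n : ℕ}

/-- The agent's set of best responses to the strategy `x`. -/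
def bestResponses (G : SecurityGame n) (x : Fin n → ℝ) : Set (Fin n) :=
  {y | ∀ y', G.v y' (x y') ≤ G.v y (x y)}

/-- The best response region of target `y`. -/
def region (G : SecurityGame n) (y : Fin n) : Set (Fin n → ℝ) :=
  {x | x ∈ G.X ∧ y ∈ G.bestResponses x}

/-- A strategy that covers only targets which are best responses to it. -/
def IsConservative (G : SecurityGame n) (x : Fin n → ℝ) : Prop :=
  ∀ y, 0 < x y → y ∈ G.bestResponses x

/-- The principal's payoff at `x` when the agent best responds, with ties broken in favour of the
principal: the maximum of `u y (x y)` over the (finite, non-empty) set of best responses `y`. -/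
def principalValue (G : SecurityGame n) (x : Fin n → ℝ) : ℝ :=
  sSup ((fun y => G.u y (x y)) '' G.bestResponses x)

/-- `x` is a conservative strategy that is optimal for the principal. -/
def IsConservativeOptimum (G : SecurityGame n) (x : Fin n → ℝ) : Prop :=
  x ∈ G.X ∧ G.IsConservative x ∧ ∀ x' ∈ G.X, G.principalValue x' ≤ G.principalValue x

/-- A rational number whose numerator (in absolute value) and denominator are at most `2 ^ L`. -/
def HasBits (L : ℕ) (q : ℚ) : Prop :=
  q.num.natAbs ≤ 2 ^ L ∧ q.den ≤ 2 ^ L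

/-- The bit precision assumption with parameter `L`. -/
structure BitPrecise (G : SecurityGame n) (L : ℕ) : Prop where
  linear : ∃ c d : Fin n → ℚ, (∀ y, (c y).den ≤ 2 ^ L ∧ (d y).den ≤ 2 ^ L) ∧
    ∀ y, ∀ t ∈ Set.Icc (0 : ℝ) 1, G.v y t = (d y : ℝ) - (c y : ℝ) * t
  volume_region : ∀ y, (G.region y).Nonempty →
    ENNReal.ofReal (((2 : ℝ) ^ (n * L))⁻¹) ≤ volume (G.region y)
  polytope : ∃ (m : ℕ) (a : Fin m → Fin n → ℚ) (b : Fin m → ℚ),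
    (∀ i, HasBits L (b i) ∧ ∀ j, HasBits L (a i j)) ∧
    G.X = {x | x ∈ Set.Icc 0 1 ∧ ∀ i, ∑ j, (a i j : ℝ) * x j ≤ (b i : ℝ)}

/-- `oracle k x` is the answer to the `k`-th query, made at `x`. Every answer is a best response;
ties may be broken arbitrarily and differently at every query. -/
def IsBestResponseOracle (G : SecurityGame n) (oracle : ℕ → (Fin n → ℝ) → Fin n) : Prop :=
  ∀ k, ∀ x ∈ G.X, oracle k x ∈ G.bestResponses x

end SecurityGame

namespace Clinch

variable {n : ℕ}

open Classical in
/-- The loop `while cond do body`, started at `s`. It is defined exactly if the loop terminates,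
and then its value is the first iterate at which `cond` fails. -/
def whileLoop {σ : Type} (cond : σ → Prop) (body : σ → σ) (s : σ) : Part σ :=
  ⟨∃ k : ℕ, ¬ cond (body^[k] s), fun h => body^[Nat.find h] s⟩

/-- The mean of the uniform distribution on a convex set `S`, that is, of the normalized
`d`-dimensional measure on `S`, where `d` is the dimension of `S`. -/
def centroid (S : Set (Fin n → ℝ)) : Fin n → ℝ :=
  ⨍ x in S, x ∂(Measure.hausdorffMeasure (Module.finrank ℝ (vectorSpan ℝ S) : ℝ))

/-- The variables of the binary search for one target, with the number of queries made so far. -/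
structure SearchState where
  lower : ℝ
  upper : ℝ
  queries : ℕ

open Classical in
/-- One round of the binary search for target `y`, at the strategy `x`. -/
def searchStep (oracle : ℕ → (Fin n → ℝ) → Fin n) (x : Fin n → ℝ) (y : Fin n)
    (s : SearchState) : SearchState :=
  let m := (s.upper + s.lower) / 2
  if oracle s.queries (x + Pi.single y (m - x y)) = y then
    { lower := m, upper := s.upper, queries := s.queries + 1 }
  else
    { lower := s.lower, upper := m, queries := s.queries + 1 }

/-- A strategy together with the total number of oracle queries made so far. -/
structure Output (n : ℕ) where
  strategy : Fin n → ℝ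
  queries : ℕ

/-- `ConserveMass`: for each target in turn, a binary search between `lo y` and `x y`;
`k` is the number of queries made before the call. -/
def conserveMass (oracle : ℕ → (Fin n → ℝ) → Fin n) (lam : ℝ) (lo x : Fin n → ℝ) (k : ℕ) :
    Part (Output n) :=
  (List.finRange n).foldlM
    (fun (out : Output n) (y : Fin n) =>
      (whileLoop (fun s : SearchState => lam ≤ s.upper - s.lower) (searchStep oracle x y)
          { lower := lo y, upper := x y, queries := out.queries }).map
        (fun s => { strategy := Function.update out.strategy y s.lower, queries := s.queries }))
    { strategy := x, queries := k }

/-- The variables of the main loop of `Clinch`, with the number of queries made so far. -/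
structure State (n : ℕ) where
  lo : Fin n → ℝ
  up : Fin n → ℝ
  S : Set (Fin n → ℝ)
  active : Set (Fin n)
  x : Fin n → ℝ
  y : Fin n
  queries : ℕ

open Classical in
/-- The body of the main loop: lock the coordinates `y'` with `lo + lam • e_{y'} ∉ S`, recompute
`S`, query its centroid, and raise the lower bound of the attacked target. -/
def mainStep (X : Set (Fin n → ℝ)) (C ε lam : ℝ) (oracle : ℕ → (Fin n → ℝ) → Fin n)
    (s : State n) : State n :=
  let up' : Fin n → ℝ := fun y' => if s.lo + Pi.single y' lam ∈ s.S then s.up y' else s.lo y'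
  let S' : Set (Fin n → ℝ) := {z | z ∈ X ∧ s.lo ≤ z ∧ z ≤ up'}
  let x' := centroid S'
  let y' := oracle s.queries x'
  { lo := Function.update s.lo y' (x' y' - C * ε)
    up := up'
    S := S'
    active := s.active \ {z | s.lo + Pi.single z lam ∉ s.S}
    x := x'
    y := y'
    queries := s.queries + 1 }

/-- The algorithm `Clinch` with slope bound `C`, oracle accuracy `ε`, target accuracy `δ` and initial
entrywise bounds `lo`, `up`. The initial value of the variable `x` is never read. -/
def clinch [NeZero n] (X : Set (Fin n → ℝ)) (C ε δ : ℝ) (lo up : Fin n → ℝ)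
    (oracle : ℕ → (Fin n → ℝ) → Fin n) : Part (Output n) :=
  let lam := δ / (4 * C ^ 2)
  (whileLoop (fun s : State n => s.y ∈ s.active) (mainStep X C ε lam oracle)
      { lo := lo, up := up, S := X, active := Set.univ, x := lo, y := 0, queries := 0 }).bind
    (fun s => conserveMass oracle lam s.lo s.x s.queries)

/-- The points of `A` that are nearest to `t`. -/
def nearestPoints (A : Set ℝ) (t : ℝ) : Set ℝ :=
  {s | s ∈ A ∧ ∀ r ∈ A, |t - s| ≤ |t - r|}

/-- The rational numbers with denominator at most `Q`. -/
def fractions (Q : ℕ) : Set ℝ :=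
  {s | ∃ q : ℚ, q.den ≤ Q ∧ s = (q : ℝ)}

/-- The integer multiples of `h`. -/
def multiples (h : ℝ) : Set ℝ :=
  {s | ∃ k : ℤ, s = (k : ℝ) * h}

end Clinch

end

/-! Holding the agent to a payoff of at most `w` has a least strategy, `levelStrategy c d w`. Every
conservative strategy has this form, and the optimal one sits at the least feasible level
(`isConservativeOptimum_iff`). A best response to any feasible strategy pays the agent at least that
level, so it is covered no more than in the optimum (`IsMinLevel.coord_le`). Hence every answer of
the oracle yields a valid lower bound.

The number of rounds is bounded through the volume of `thickened`: the remaining face, in its own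
coordinates, times a box of side `κ` for the locked coordinates. The dimension therefore never
drops, and the means over this set are those over the face (`centroid_face`). The set is downward
closed, and cutting such a set through its mean in a coordinate direction leaves at most half of it
(`volume_inter_le_half`). Locking does not increase the volume (`volume_thickened_anti`). The volume
starts at most `1` and stays at least `κ ^ n`, which leaves `O(n ^ 2 * L)` rounds.

When the answer is a locked target, that target is within `lam` of its optimal coverage, so the
agent's payoff is within `lam` of the least level. The binary searches then approximate the optimum
from below; passing from payoffs back to coverage costs a factor `C`.

Rounding works because some constraint is tight at the optimum and pins the level down
(`exists_tight`). Clearing denominators gives coordinates with denominator at most `2 ^ (4 * L * n)`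
(`den_solution_le`), and distinct rationals of this kind are three accuracies apart. -/

open MeasureTheory

noncomputable section

/-! ### Denominators of the solution of the tight equation -/

/-- Scaling `q` by its own denominator. -/
theorem Rat.den_mul_mem_range (q : ℚ) : (q.den : ℚ) * q ∈ (Int.castRingHom ℚ).range :=
  ⟨q.num, by simp [Rat.den_mul_eq_num]⟩

/-- The reduced denominator divides every positive integer that clears the fraction. Phrasing
integrality as membership in a subring lets closure under sums and products do the bookkeeping. -/
theorem Rat.den_le_of_mul_mem_range {q D : ℚ} {B : ℕ} (hD : D ∈ (Int.castRingHom ℚ).range)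
    (hD0 : 0 < D) (hB : D ≤ B) (hqD : D * q ∈ (Int.castRingHom ℚ).range) : q.den ≤ B := by
  obtain ⟨k, rfl⟩ := hD
  obtain ⟨z, hz⟩ := hqD
  simp only [eq_intCast] at *
  have hk : 0 < k := by exact_mod_cast hD0
  have hq : q = Rat.divInt z k := by
    rw [Rat.divInt_eq_div, hz]
    field_simp
  have h1 := Int.le_of_dvd hk (hq ▸ Rat.den_dvd z k)
  have h2 : k ≤ B := by exact_mod_cast hB
  exact_mod_cast h1.trans h2

namespace SecurityGame

theorem HasBits.zero (L : ℕ) : HasBits L 0 := by simp [HasBits, Nat.one_le_two_pow]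

theorem HasBits.one (L : ℕ) : HasBits L 1 := by simp [HasBits, Nat.one_le_two_pow]

/-- Cramer's rule for the common value `w` of the affine functions `d j - c j * t` on a
hyperplane `∑ j, a j * t j = b`: the solution has small denominators. -/
theorem den_solution_le {n L : ℕ} (a c d : Fin n → ℚ) (b : ℚ) (hL : 1 ≤ L)
    (ha : ∀ j, HasBits L (a j)) (hb : HasBits L b) (hc0 : ∀ j, 0 < c j)
    (hc : ∀ j, HasBits L (c j)) (hd : ∀ j, (d j).den ≤ 2 ^ L)
    (hσ : 0 < ∑ j, a j / c j) (y : Fin n) :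
    ((∑ j, a j / c j * (d y - d j) + b) / (c y * ∑ j, a j / c j)).den ≤ 2 ^ (4 * L * n) := by
  classical
  set R := (Int.castRingHom ℚ).range with hR
  have natR : ∀ k : ℕ, (k : ℚ) ∈ R := fun k => natCast_mem R k
  have intR : ∀ k : ℤ, (k : ℚ) ∈ R := fun k => intCast_mem R k
  set σ := ∑ j, a j / c j with hσdef
  -- This multiplier makes both `a j / c j` and `1 / c j` integral.
  let P : Fin n → ℚ := fun j => (a j).den * (c j).num
  have hP0 : ∀ j, 0 < P j := fun j => mul_pos (by exact_mod_cast (a j).den_pos)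
    (by exact_mod_cast Rat.num_pos.2 (hc0 j))
  have hPR : ∀ j, P j ∈ R := fun j => mul_mem (natR _) (intR _)
  have hac : ∀ j, P j * (a j / c j) = (a j).num * (c j).den := by
    intro j
    have h1 : (a j).den * a j = (a j).num := Rat.den_mul_eq_num (a j)
    have h2 : (c j).den * c j = (c j).num := Rat.den_mul_eq_num (c j)
    have := (hc0 j).ne'
    simp only [P]
    rw [← h1, ← h2]
    field_simp
  let Q : ℚ := ∏ j, ((d j).den : ℚ)
  have hQ0 : 0 < Q := Finset.prod_pos fun j _ => by exact_mod_cast (d j).den_pos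
  have hQR : Q ∈ R := prod_mem fun j _ => natR _
  have hQd : ∀ j, Q * d j ∈ R := by
    intro j
    have : Q = (∏ l ∈ Finset.univ.erase j, ((d l).den : ℚ)) * (d j).den :=
      (Finset.prod_erase_mul _ _ (Finset.mem_univ j)).symm
    rw [this, mul_assoc]
    exact mul_mem (prod_mem fun l _ => natR _) (Rat.den_mul_mem_range _)
  have hb0 : (0 : ℚ) < b.den := by exact_mod_cast b.den_pos
  let W : ℚ := ∏ j, P j
  have hW0 : 0 < W := Finset.prod_pos fun j _ => hP0 j
  have hWe : ∀ j, W = (∏ l ∈ Finset.univ.erase j, P l) * P j :=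
    fun j => (Finset.prod_erase_mul _ _ (Finset.mem_univ j)).symm
  have hWt : ∀ j, W * (a j / c j)
      = (∏ l ∈ Finset.univ.erase j, P l) * ((a j).num * (c j).den) := by
    intro j; rw [hWe j, mul_assoc, hac]
  have hWσ : W * σ ∈ R := by
    rw [hσdef, Finset.mul_sum]
    refine sum_mem fun j _ => ?_
    rw [hWt]
    exact mul_mem (prod_mem fun l _ => hPR l) (mul_mem (intR _) (natR _))
  have hPle : ∀ j, P j ≤ 2 ^ (2 * L) := by
    intro j
    have h1 : ((a j).den : ℚ) ≤ 2 ^ L := by exact_mod_cast (ha j).2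
    have h2 : ((c j).num : ℚ) ≤ 2 ^ L := by
      have : (c j).num ≤ 2 ^ L := by
        have := (hc j).1
        zify at this
        exact (le_abs_self _).trans this
      exact_mod_cast this
    calc P j ≤ 2 ^ L * 2 ^ L := mul_le_mul h1 h2 (by exact_mod_cast (Rat.num_pos.2 (hc0 j)).le)
          (by positivity)
      _ = 2 ^ (2 * L) := by ring
  have hWσle : W * σ ≤ n * (2 ^ (2 * L)) ^ n := by
    rw [hσdef, Finset.mul_sum]
    calc ∑ j, W * (a j / c j) ≤ ∑ j : Fin n, (2 ^ (2 * L) : ℚ) ^ n := by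
          refine Finset.sum_le_sum fun j _ => ?_
          rw [hWt]
          have h1 : ((a j).num : ℚ) ≤ 2 ^ L := by
            have : (a j).num ≤ 2 ^ L := by
              have := (ha j).1
              zify at this
              exact (le_abs_self _).trans this
            exact_mod_cast this
          have h2 : ((c j).den : ℚ) ≤ 2 ^ L := by exact_mod_cast (hc j).2
          have h3 : (∏ l ∈ Finset.univ.erase j, P l) ≤ (2 ^ (2 * L) : ℚ) ^ (n - 1) := by
            calc (∏ l ∈ Finset.univ.erase j, P l)
                ≤ ∏ l ∈ Finset.univ.erase j, (2 ^ (2 * L) : ℚ) :=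
                  Finset.prod_le_prod (fun l _ => (hP0 l).le) fun l _ => hPle l
              _ = _ := by simp
          have h4 : ((a j).num : ℚ) * (c j).den ≤ 2 ^ (2 * L) := by
            calc ((a j).num : ℚ) * (c j).den ≤ 2 ^ L * 2 ^ L :=
                  mul_le_mul h1 h2 (by positivity) (by positivity)
              _ = _ := by ring
          have hn : n = (n - 1) + 1 := by have := j.pos; omega
          calc (∏ l ∈ Finset.univ.erase j, P l) * ((a j).num * (c j).den)
              ≤ (∏ l ∈ Finset.univ.erase j, P l) * 2 ^ (2 * L) :=
                mul_le_mul_of_nonneg_left h4 (Finset.prod_nonneg fun l _ => (hP0 l).le)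
            _ ≤ (2 ^ (2 * L) : ℚ) ^ (n - 1) * 2 ^ (2 * L) := by gcongr
            _ = (2 ^ (2 * L) : ℚ) ^ n := by rw [← pow_succ, ← hn]
      _ = n * (2 ^ (2 * L)) ^ n := by simp
  have hQle : Q ≤ (2 ^ L) ^ n := by
    calc Q ≤ ∏ j : Fin n, (2 ^ L : ℚ) :=
          Finset.prod_le_prod (fun _ _ => by positivity) fun j _ => by exact_mod_cast hd j
      _ = _ := by simp
  have hble : (b.den : ℚ) ≤ 2 ^ L := by exact_mod_cast hb.2
  -- The `n` summands of `W * σ` cost at most `L * (n - 1)` bits. Together with `L` for `b`, `L * n`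
  -- for `Q` and `2 * L * n` for each summand this makes exactly `4 * L * n`.
  have hn : n ≤ 2 ^ (n - 1) := by
    rcases n with _ | n
    · simp
    · simpa using Nat.lt_two_pow_self (n := n)
  have hnpos := y.pos
  refine Rat.den_le_of_mul_mem_range (D := b.den * Q * (W * σ)) ?_ (by positivity) ?_ ?_
  · exact mul_mem (mul_mem (natR _) hQR) hWσ
  · have h5 : (n : ℚ) ≤ 2 ^ (L * (n - 1)) := by
      have : n ≤ 2 ^ (L * (n - 1)) := hn.trans (Nat.pow_le_pow_right (by norm_num) (by nlinarith))
      exact_mod_cast this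
    calc (b.den : ℚ) * Q * (W * σ) ≤ 2 ^ L * (2 ^ L) ^ n * (n * (2 ^ (2 * L)) ^ n) := by
          gcongr
      _ ≤ 2 ^ L * (2 ^ L) ^ n * (2 ^ (L * (n - 1)) * (2 ^ (2 * L)) ^ n) := by gcongr
      _ = ((2 ^ (4 * L * n) : ℕ) : ℚ) := by
          obtain ⟨k, rfl⟩ : ∃ k, n = k + 1 := ⟨n - 1, by omega⟩
          push_cast
          simp only [← pow_mul, ← pow_add]
          congr 1
          ring
  · have hcy := (hc0 y).ne'
    have hσ' := hσ.ne'
    have hac' : (P y : ℚ) / c y = (a y).den * (c y).den := by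
      have h2 : (c y).den * c y = (c y).num := Rat.den_mul_eq_num (c y)
      simp only [P]
      rw [← h2]
      field_simp
    have key : b.den * Q * (W * σ) * ((∑ j, a j / c j * (d y - d j) + b) / (c y * σ))
        = ∑ j, b.den * (W * (a j / c j) / c y) * (Q * d y - Q * d j)
          + Q * (W / c y) * (b.den * b) := by
      have : ∑ j, b.den * (W * (a j / c j) / c y) * (Q * d y - Q * d j)
          = (b.den * W * Q / c y) * ∑ j, a j / c j * (d y - d j) := by
        rw [Finset.mul_sum]
        refine Finset.sum_congr rfl fun j _ => ?_
        ring
      rw [this]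
      field_simp
    have hWy : ∀ s : Finset (Fin n), y ∈ s → (∏ l ∈ s, P l) / c y ∈ R := by
      intro s hs
      rw [← Finset.prod_erase_mul _ _ hs, mul_div_assoc, hac']
      exact mul_mem (prod_mem fun l _ => hPR l) (mul_mem (natR _) (natR _))
    rw [key]
    refine add_mem (sum_mem fun j _ => ?_) ?_
    -- For `j = y` the summand vanishes. For `j ≠ y` the factor `P y` is still present in the
    -- product without `P j`, and it absorbs the division by `c y`.
    · rcases eq_or_ne j y with rfl | hj
      · simp
      · refine mul_mem (mul_mem (natR _) ?_) (sub_mem (hQd y) (hQd j))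
        rw [hWt, mul_comm, mul_div_assoc]
        exact mul_mem (mul_mem (intR _) (natR _)) (hWy _ (by simp [hj.symm]))
    · exact mul_mem (mul_mem hQR (hWy _ (Finset.mem_univ y))) (Rat.den_mul_mem_range b)

end SecurityGame

/-! ### Rounding to a separated set -/

namespace Clinch

/-- By the triangle inequality every other point of `A` is at distance at least `2 / 3 * h` from
`t`. -/
theorem nearestPoints_eq_singleton {A : Set ℝ} {h t s : ℝ} (hs : s ∈ A) (hh : 0 < h)
    (hA : ∀ r ∈ A, r ≠ s → h ≤ |r - s|) (ht : |t - s| ≤ 1 / 3 * h) :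
    nearestPoints A t = {s} := by
  have far : ∀ r ∈ A, r ≠ s → |t - s| < |t - r| := by
    intro r hr hrs
    have h1 := hA r hr hrs
    have h2 : |r - s| ≤ |t - s| + |t - r| := by
      have := abs_sub_le r t s
      rw [abs_sub_comm r t] at this
      linarith
    linarith
  ext r
  simp only [nearestPoints, Set.mem_ofPred_eq, Set.mem_singleton_iff]
  constructor
  · rintro ⟨hr, hmin⟩
    by_contra hrs
    exact absurd (hmin s hs) (not_le.2 (far r hr hrs))
  · rintro rfl
    refine ⟨hs, fun r' hr' => ?_⟩
    rcases eq_or_ne r' r with rfl | hne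
    · exact le_rfl
    · exact (far r' hr' hne).le

/-- The difference has a non-zero integer numerator and a denominator dividing the product of the
two denominators. -/
theorem fractions_separated {Q : ℕ} {r s : ℝ} (hr : r ∈ fractions Q) (hs : s ∈ fractions Q)
    (hne : r ≠ s) : (((Q : ℝ) ^ 2)⁻¹) ≤ |r - s| := by
  obtain ⟨p, hp, rfl⟩ := hr
  obtain ⟨q, hq, rfl⟩ := hs
  have hne' : p - q ≠ 0 := sub_ne_zero.2 fun h => hne (by rw [h])
  have hden : (p - q).den ≤ Q ^ 2 := by
    calc (p - q).den ≤ p.den * q.den :=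
          Nat.le_of_dvd (Nat.mul_pos p.den_pos q.den_pos) (Rat.sub_den_dvd p q)
      _ ≤ Q ^ 2 := by rw [sq]; exact Nat.mul_le_mul hp hq
  have hden0 : (0 : ℝ) < (p - q).den := by exact_mod_cast (p - q).den_pos
  have hnum : (1 : ℝ) ≤ |((p - q).num : ℝ)| := by
    have : 1 ≤ |(p - q).num| := Int.one_le_abs (Rat.num_ne_zero.2 hne')
    exact_mod_cast this
  have hcast : (p : ℝ) - q = ((p - q).num : ℝ) / (p - q).den := by
    rw [← Rat.cast_sub]
    exact Rat.cast_def _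
  rw [hcast, abs_div, abs_of_pos hden0, inv_eq_one_div]
  have : ((p - q).den : ℝ) ≤ (Q : ℝ) ^ 2 := by exact_mod_cast hden
  gcongr

theorem multiples_separated {h r s : ℝ} (hh : 0 < h) (hr : r ∈ multiples h)
    (hs : s ∈ multiples h) (hne : r ≠ s) : h ≤ |r - s| := by
  obtain ⟨k, rfl⟩ := hr
  obtain ⟨l, rfl⟩ := hs
  have hkl : k - l ≠ 0 := sub_ne_zero.2 fun h => hne (by rw [h])
  have : (1 : ℝ) ≤ |((k - l : ℤ) : ℝ)| := by exact_mod_cast Int.one_le_abs hkl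
  rw [← sub_mul, abs_mul, abs_of_pos hh, ← Int.cast_sub]
  nlinarith

end Clinch

/-! ### Levels and conservative strategies -/

namespace SecurityGame

variable {n : ℕ}

/-- The agent's payoffs are affine, `v y t = d y - c y * t`, with slopes in `(0, 1]`. -/
structure IsAffine (G : SecurityGame n) (c d : Fin n → ℝ) : Prop where
  pos : ∀ y, 0 < c y
  le_one : ∀ y, c y ≤ 1
  eq : ∀ y, ∀ t ∈ Set.Icc (0 : ℝ) 1, G.v y t = d y - c y * t

/-- The smallest coverage that keeps all payoffs of the agent at most `w`. -/
def levelStrategy (c d : Fin n → ℝ) (w : ℝ) : Fin n → ℝ := fun y => max 0 ((d y - w) / c y)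

/-- `w` is the smallest payoff to which the principal can hold the agent. -/
structure IsMinLevel (G : SecurityGame n) (c d : Fin n → ℝ) (w : ℝ) : Prop where
  mem : levelStrategy c d w ∈ G.X
  exists_eq : ∃ y, d y - c y * levelStrategy c d w y = w
  le : ∀ x ∈ G.X, ∃ y, w ≤ d y - c y * x y

variable {G : SecurityGame n} {c d : Fin n → ℝ} {w : ℝ} {x : Fin n → ℝ} {y : Fin n}

theorem coord_mem (hx : x ∈ G.X) (y : Fin n) : x y ∈ Set.Icc (0 : ℝ) 1 :=
  ⟨(G.subset_cube hx).1 y, (G.subset_cube hx).2 y⟩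

theorem levelStrategy_nonneg (c d : Fin n → ℝ) (w : ℝ) : 0 ≤ levelStrategy c d w :=
  fun _ => le_max_left _ _

namespace IsAffine

theorem mem_bestResponses_iff (h : G.IsAffine c d) (hx : x ∈ G.X) :
    y ∈ G.bestResponses x ↔ ∀ y', d y' - c y' * x y' ≤ d y - c y * x y := by
  simp only [bestResponses, Set.mem_ofPred_eq]
  refine forall_congr' fun y' => ?_
  rw [h.eq _ _ (coord_mem hx y'), h.eq _ _ (coord_mem hx y)]

/-- The Galois connection between coverage and payoff, the usual way to bound `levelStrategy` from
above. -/
theorem levelStrategy_le_iff (h : G.IsAffine c d) {t : ℝ} (ht : 0 ≤ t) :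
    levelStrategy c d w y ≤ t ↔ d y - c y * t ≤ w := by
  rw [levelStrategy, max_le_iff, div_le_iff₀ (h.pos y)]
  constructor
  · rintro ⟨-, h2⟩; linarith
  · intro h2; exact ⟨ht, by linarith⟩

theorem payoff_levelStrategy_le (h : G.IsAffine c d) (w : ℝ) (y : Fin n) :
    d y - c y * levelStrategy c d w y ≤ w :=
  (h.levelStrategy_le_iff (levelStrategy_nonneg c d w y)).1 le_rfl

theorem le_levelStrategy (h : G.IsAffine c d) {t : ℝ} (ht : w ≤ d y - c y * t) :
    t ≤ levelStrategy c d w y := by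
  refine le_trans ?_ (le_max_right _ _)
  rw [le_div_iff₀ (h.pos y)]; linarith

theorem payoff_levelStrategy_of_pos (h : G.IsAffine c d)
    (hy : 0 < levelStrategy c d w y) : d y - c y * levelStrategy c d w y = w := by
  have hc := (h.pos y).ne'
  have : levelStrategy c d w y = (d y - w) / c y := by
    rw [levelStrategy]
    refine max_eq_right (le_of_lt ?_)
    simpa [levelStrategy] using hy
  rw [this]
  field_simp
  ring

/-- Levels depend on the agent's payoff in a Lipschitz way. -/
theorem levelStrategy_le_add (h : G.IsAffine c d) {w' ε C : ℝ} (hw : w' ≤ w + ε)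
    (hε : 0 ≤ ε) (hC : ∀ y, 1 ≤ C * c y) (y : Fin n) :
    levelStrategy c d w y ≤ levelStrategy c d w' y + C * ε := by
  have hC0 : 0 ≤ C := by
    by_contra hneg
    nlinarith [hC y, h.pos y]
  have h0 := levelStrategy_nonneg c d w' y
  have h0' : (0 : ℝ) ≤ levelStrategy c d w' y := h0
  rw [h.levelStrategy_le_iff (by positivity)]
  have h1 := h.payoff_levelStrategy_le w' y
  nlinarith [hC y]

/-- By compactness the largest payoff attains its minimum `w` over `G.X`. The level strategy of `w`
lies below the minimizer, so downward closure makes it feasible. -/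
theorem exists_isMinLevel [NeZero n] (h : G.IsAffine c d) : ∃ w, G.IsMinLevel c d w := by
  have hne : (Finset.univ : Finset (Fin n)).Nonempty := Finset.univ_nonempty
  have hcomp : IsCompact G.X := isCompact_Icc.of_isClosed_subset G.isClosed G.subset_cube
  have hcont : Continuous fun x : Fin n → ℝ =>
      Finset.univ.sup' hne fun y => d y - c y * x y :=
    Continuous.finset_sup'_apply hne fun y _ => by fun_prop
  obtain ⟨x₀, hx₀, hmin⟩ := hcomp.exists_isMinOn G.nonempty hcont.continuousOn
  set w := Finset.univ.sup' hne fun y => d y - c y * x₀ y with hw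
  have hle : ∀ y, d y - c y * x₀ y ≤ w := fun y =>
    Finset.le_sup' (fun y => d y - c y * x₀ y) (Finset.mem_univ y)
  have hle' : levelStrategy c d w ≤ x₀ := fun y =>
    (h.levelStrategy_le_iff (coord_mem hx₀ y).1).2 (hle y)
  refine ⟨w, G.downward_closed _ hx₀ _ (levelStrategy_nonneg _ _ _) hle', ?_, fun x hx => ?_⟩
  · obtain ⟨y, -, hy⟩ := Finset.exists_mem_eq_sup' hne fun y => d y - c y * x₀ y
    refine ⟨y, le_antisymm (h.payoff_levelStrategy_le w y) ?_⟩
    have h1 := mul_le_mul_of_nonneg_left (hle' y) (h.pos y).le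
    linarith
  · obtain ⟨y, -, hy⟩ := Finset.exists_mem_eq_sup' hne fun y => d y - c y * x y
    exact ⟨y, hy ▸ hmin hx⟩

end IsAffine

theorem bestResponses_nonempty [NeZero n] (G : SecurityGame n) (x : Fin n → ℝ) :
    (G.bestResponses x).Nonempty := by
  obtain ⟨y, -, hy⟩ := Finset.exists_max_image (Finset.univ : Finset (Fin n))
    (fun y => G.v y (x y)) Finset.univ_nonempty
  exact ⟨y, fun y' => hy y' (Finset.mem_univ y')⟩

theorem exists_principalValue_eq [NeZero n] (G : SecurityGame n) (x : Fin n → ℝ) :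
    ∃ y ∈ G.bestResponses x, G.principalValue x = G.u y (x y) := by
  have := ((G.bestResponses_nonempty x).image fun y => G.u y (x y)).csSup_mem
    ((Set.toFinite _).image _)
  obtain ⟨y, hy, hyx⟩ := this
  exact ⟨y, hy, hyx.symm⟩

theorem le_principalValue (G : SecurityGame n) (hy : y ∈ G.bestResponses x) :
    G.u y (x y) ≤ G.principalValue x :=
  le_csSup ((Set.toFinite _).image _).bddAbove ⟨y, hy, rfl⟩

namespace IsMinLevel

/-- A covered best response is covered at most as in the strategy of minimal level. -/
theorem coord_le (h : G.IsAffine c d) (hw : G.IsMinLevel c d w) (hx : x ∈ G.X)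
    (hy : y ∈ G.bestResponses x) : x y ≤ levelStrategy c d w y := by
  obtain ⟨y', hy'⟩ := hw.le x hx
  exact h.le_levelStrategy (hy'.trans ((h.mem_bestResponses_iff hx).1 hy y'))

theorem mem_bestResponses (h : G.IsAffine c d) (hw : G.IsMinLevel c d w)
    (hy : d y - c y * levelStrategy c d w y = w) :
    y ∈ G.bestResponses (levelStrategy c d w) :=
  (h.mem_bestResponses_iff hw.mem).2 fun y' => (h.payoff_levelStrategy_le w y').trans_eq hy.symm

/-- Covered targets are best responses, so they share the payoff of `y` and are covered exactly to
that level; uncovered targets already pay at most as much. -/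
theorem eq_of_isConservative (h : G.IsAffine c d) (hx : x ∈ G.X)
    (hcons : G.IsConservative x) (hy : y ∈ G.bestResponses x) :
    x = levelStrategy c d (d y - c y * x y) := by
  have hbr := (h.mem_bestResponses_iff hx).1 hy
  funext y'
  refine le_antisymm ?_ ((h.levelStrategy_le_iff (coord_mem hx y').1).2 (hbr y'))
  rcases (coord_mem hx y').1.eq_or_lt with h0 | h0
  · rw [← h0]; exact levelStrategy_nonneg _ _ _ _
  · exact h.le_levelStrategy ((h.mem_bestResponses_iff hx).1 (hcons y' h0) y)

theorem isConservativeOptimum_iff [NeZero n] (h : G.IsAffine c d) (hw : G.IsMinLevel c d w) :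
    G.IsConservativeOptimum x ↔ x = levelStrategy c d w := by
  -- at a lower level, every best response is still one and is covered at least as much
  have key : ∀ z ∈ G.X, ∀ y ∈ G.bestResponses z,
      z y ≤ levelStrategy c d w y ∧ y ∈ G.bestResponses (levelStrategy c d w) := by
    intro z hz y hy
    have hle := hw.coord_le h hz hy
    refine ⟨hle, hw.mem_bestResponses h ?_⟩
    rcases (coord_mem hz y).1.trans hle |>.eq_or_lt with h0 | h0
    · have hz0 : z y = levelStrategy c d w y :=
        le_antisymm hle (h0 ▸ (coord_mem hz y).1)
      refine le_antisymm (h.payoff_levelStrategy_le w y) ?_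
      obtain ⟨y', hy'⟩ := hw.le z hz
      rw [← hz0]
      exact hy'.trans ((h.mem_bestResponses_iff hz).1 hy y')
    · exact h.payoff_levelStrategy_of_pos h0
  constructor
  · rintro ⟨hx, hcons, hopt⟩
    obtain ⟨y, hy, hval⟩ := G.exists_principalValue_eq x
    have hxe := eq_of_isConservative h hx hcons hy
    set w' := d y - c y * x y with hw'
    obtain ⟨hle, hy'⟩ := key x hx y hy
    have h1 := (G.le_principalValue hy').trans ((hopt _ hw.mem).trans_eq hval)
    have h2 := ((G.u_strictMono y).le_iff_le (coord_mem hw.mem y) (coord_mem hx y)).1 h1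
    have hxy : x y = levelStrategy c d w y := le_antisymm hle h2
    have : w' = w := by
      obtain ⟨y₁, hy₁⟩ := hw.le x hx
      refine le_antisymm ?_ (hy₁.trans ((h.mem_bestResponses_iff hx).1 hy y₁))
      rw [hw', hxy]
      exact h.payoff_levelStrategy_le w y
    rw [hxe, this]
  · rintro rfl
    refine ⟨hw.mem, fun y hy => hw.mem_bestResponses h (h.payoff_levelStrategy_of_pos hy), ?_⟩
    intro z hz
    obtain ⟨y, hy, hval⟩ := G.exists_principalValue_eq z
    obtain ⟨hle, hy'⟩ := key z hz y hy
    rw [hval]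
    refine le_trans ?_ (G.le_principalValue hy')
    exact (G.u_strictMono y).monotoneOn (coord_mem hz y) (coord_mem hw.mem y) hle

/-- Some constraint that binds at the strategy of minimal level gets violated when the level is
lowered. -/
theorem exists_tight {ι : Type*} [Finite ι] {a : ι → Fin n → ℝ} {b : ι → ℝ}
    (h : G.IsAffine c d) (hw : G.IsMinLevel c d w)
    (hX : G.X = {x | 0 ≤ x ∧ ∀ i, ∑ j, a i j * x j ≤ b i}) :
    ∃ i, ∑ j, (if w ≤ d j then a i j else 0) * ((d j - w) / c j) = b i ∧
      0 < ∑ j, (if w ≤ d j then a i j else 0) / c j := by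
  by_contra! hno
  -- The direction in which the level strategy moves as the level falls. Targets with `d j = w` are
  -- included because they must be covered as soon as the level drops.
  set g : Fin n → ℝ := fun j => if w ≤ d j then 1 / c j else 0 with hg
  have hg0 : ∀ j, 0 ≤ g j := fun j => by
    simp only [hg]; split_ifs
    · exact (one_div_pos.2 (h.pos j)).le
    · exact le_rfl
  set p := levelStrategy c d w with hp
  have hmem := hw.mem
  rw [hX] at hmem
  have hpj : ∀ i, ∑ j, (if w ≤ d j then a i j else 0) * ((d j - w) / c j)
      = ∑ j, a i j * p j := by
    intro i
    refine Finset.sum_congr rfl fun j _ => ?_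
    simp only [hp, levelStrategy]
    split_ifs with hj
    · rw [max_eq_right (div_nonneg (sub_nonneg.2 hj) (h.pos j).le)]
    · rw [max_eq_left (div_nonpos_of_nonpos_of_nonneg (by linarith) (h.pos j).le)]
      simp
  have hgj : ∀ i, ∑ j, (if w ≤ d j then a i j else 0) / c j = ∑ j, a i j * g j := by
    intro i
    refine Finset.sum_congr rfl fun j _ => ?_
    simp only [hg]
    split_ifs <;> simp [div_eq_mul_inv]
  have hlin : ∀ i (ε : ℝ), ∑ j, a i j * (p j + ε * g j)
      = ∑ j, a i j * p j + ε * ∑ j, a i j * g j := by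
    intro i ε
    rw [Finset.mul_sum, ← Finset.sum_add_distrib]
    exact Finset.sum_congr rfl fun j _ => by ring
  have hev : ∀ᶠ ε : ℝ in nhdsWithin 0 (Set.Ioi 0), ∀ i,
      ∑ j, a i j * (p j + ε * g j) ≤ b i := by
    rw [Filter.eventually_all]
    intro i
    rcases (hmem.2 i).eq_or_lt with htight | hslack
    · have h1 := hno i (by rw [hpj, htight])
      rw [hgj] at h1
      filter_upwards [self_mem_nhdsWithin] with ε hε
      rw [hlin, htight]
      have hε' : 0 < ε := hε
      nlinarith
    · have hc : Continuous fun ε : ℝ => ∑ j, a i j * (p j + ε * g j) := by fun_prop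
      have : ∀ᶠ ε : ℝ in nhds 0, ∑ j, a i j * (p j + ε * g j) < b i := by
        refine hc.continuousAt.eventually_lt continuousAt_const ?_
        simpa using hslack
      filter_upwards [nhdsWithin_le_nhds this] with ε hε using hε.le
  obtain ⟨ε, hεi, hε⟩ := (hev.and self_mem_nhdsWithin).exists
  have hε' : 0 < ε := hε
  have hmem' : (fun j => p j + ε * g j) ∈ G.X := by
    rw [hX]
    exact ⟨fun j => add_nonneg (hmem.1 j) (mul_nonneg hε'.le (hg0 j)), hεi⟩
  -- After a small step along `g` all payoffs are strictly below `w`, by `ε` where `w ≤ d j` and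
  -- because of `d j < w` elsewhere. This contradicts minimality.
  obtain ⟨y, hy⟩ := hw.le _ hmem'
  have h1 := h.payoff_levelStrategy_le w y
  have hc := h.pos y
  simp only [hg, mul_add] at hy
  split_ifs at hy with hyw
  · have : c y * (ε * (1 / c y)) = ε := by field_simp
    linarith
  · have h2 : 0 ≤ c y * p y := mul_nonneg hc.le (hmem.1 y)
    linarith

end IsMinLevel

/-! ### Denominators of the optimal strategy -/

/-- The data of the bit precision assumption, with the bounds `x j ≤ 1` among the constraints. -/
theorem BitPrecise.exists_data {L : ℕ} (hG : G.BitPrecise L) :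
    ∃ (c d : Fin n → ℚ) (m : ℕ) (a : Fin m ⊕ Fin n → Fin n → ℚ) (b : Fin m ⊕ Fin n → ℚ),
      G.IsAffine (fun y => (c y : ℝ)) (fun y => (d y : ℝ)) ∧ (∀ y, HasBits L (c y)) ∧
      (∀ y, (d y).den ≤ 2 ^ L) ∧ (∀ i, HasBits L (b i) ∧ ∀ j, HasBits L (a i j)) ∧
      G.X = {x | 0 ≤ x ∧ ∀ i, ∑ j, (a i j : ℝ) * x j ≤ (b i : ℝ)} := by
  obtain ⟨c, d, hbits, hlin⟩ := hG.linear
  obtain ⟨m, a, b, hab, hX⟩ := hG.polytope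
  have h0 : (0 : ℝ) ∈ Set.Icc (0 : ℝ) 1 := by simp
  have h1 : (1 : ℝ) ∈ Set.Icc (0 : ℝ) 1 := by simp
  have hc0 : ∀ y, (0 : ℝ) < c y := by
    intro y
    have := G.v_strictAnti y h0 h1 one_pos
    rw [hlin y 0 h0, hlin y 1 h1] at this
    linarith
  have hc1 : ∀ y, (c y : ℝ) ≤ 1 := by
    intro y
    have h2 := (G.v_mapsTo y h0).2
    have h3 := (G.v_mapsTo y h1).1
    rw [hlin y 0 h0] at h2
    rw [hlin y 1 h1] at h3
    linarith
  refine ⟨c, d, m, Sum.elim a fun k => Pi.single k 1, Sum.elim b 1, ⟨hc0, hc1, hlin⟩, ?_,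
    fun y => (hbits y).2, ?_, ?_⟩
  · intro y
    refine ⟨?_, (hbits y).1⟩
    have hn0 : 0 ≤ (c y).num := Rat.num_nonneg.2 (by exact_mod_cast (hc0 y).le)
    have hq : c y ≤ 1 := by exact_mod_cast hc1 y
    have h2 : (c y).num ≤ (c y).den := by
      rw [← Rat.num_div_den (c y), div_le_one (by exact_mod_cast (c y).den_pos)] at hq
      exact_mod_cast hq
    have := (hbits y).1
    omega
  · rintro (i | k)
    · exact hab i
    · refine ⟨HasBits.one L, fun j => ?_⟩
      rcases eq_or_ne j k with rfl | hjk
      · simpa using HasBits.one L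
      · simpa [Pi.single_eq_of_ne hjk] using HasBits.zero L
  · rw [hX]
    ext x
    simp only [Set.mem_ofPred_eq, Set.mem_Icc, Sum.forall, Sum.elim_inl, Sum.elim_inr,
      Pi.one_apply, Rat.cast_one]
    have : ∀ k : Fin n, ∑ j, (((Pi.single k 1 : Fin n → ℚ) j : ℚ) : ℝ) * x j = x k := by
      intro k
      rw [Finset.sum_eq_single k] <;> simp +contextual
    simp only [this, Pi.le_def, Pi.one_apply]
    tauto

/-- The optimal conservative strategy has coordinates with small denominators. -/
theorem BitPrecise.levelStrategy_mem_fractions {L : ℕ} (hL : 1 ≤ L) {m : ℕ} {c d : Fin n → ℚ}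
    {a : Fin m ⊕ Fin n → Fin n → ℚ} {b : Fin m ⊕ Fin n → ℚ}
    (h : G.IsAffine (fun y => (c y : ℝ)) (fun y => (d y : ℝ))) (hc : ∀ y, HasBits L (c y))
    (hd : ∀ y, (d y).den ≤ 2 ^ L) (hab : ∀ i, HasBits L (b i) ∧ ∀ j, HasBits L (a i j))
    (hX : G.X = {x | 0 ≤ x ∧ ∀ i, ∑ j, (a i j : ℝ) * x j ≤ (b i : ℝ)})
    (hw : G.IsMinLevel (fun y => (c y : ℝ)) (fun y => (d y : ℝ)) w) (y : Fin n) :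
    levelStrategy (fun y => (c y : ℝ)) (fun y => (d y : ℝ)) w y
      ∈ Clinch.fractions (2 ^ (4 * L * n)) := by
  classical
  rcases (levelStrategy_nonneg (fun y => (c y : ℝ)) (fun y => (d y : ℝ)) w y).eq_or_lt
    with h0 | hpos
  · exact ⟨0, by simp [Nat.one_le_two_pow], by rw [← h0]; simp⟩
  obtain ⟨i, hi, hσ⟩ := hw.exists_tight h hX
  have hval := h.payoff_levelStrategy_of_pos hpos
  set s := levelStrategy (fun y => (c y : ℝ)) (fun y => (d y : ℝ)) w y
  set a' : Fin n → ℚ := fun j => if w ≤ (d j : ℝ) then a i j else 0 with ha'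
  have hcast : ∀ j, (if w ≤ (d j : ℝ) then (a i j : ℝ) else 0) = ((a' j : ℚ) : ℝ) := by
    intro j; simp only [ha']; split_ifs <;> simp
  simp only [hcast] at hi hσ
  have hc0 : ∀ j, 0 < c j := fun j => by exact_mod_cast h.pos j
  -- The witness comes from solving `∑ j, a' j * (d j - w) / c j = b i` for `w` and inserting the
  -- result in `(d y - w) / c y`.
  refine ⟨_, den_solution_le a' c d (b i) hL ?_ (hab i).1 hc0 hc hd (by exact_mod_cast hσ) y, ?_⟩
  · intro j
    simp only [ha']
    split_ifs
    · exact (hab i).2 j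
    · exact HasBits.zero L
  · push_cast
    have hcy := (h.pos y).ne'
    rw [eq_div_iff (mul_ne_zero hcy hσ.ne'), ← hi, ← Finset.sum_add_distrib, Finset.mul_sum,
      Finset.mul_sum]
    refine Finset.sum_congr rfl fun j _ => ?_
    have := (h.pos j).ne'
    rw [← hval]
    field_simp
    ring

end SecurityGame

/-! ### Cuts of downward closed sets through the mean -/

/-- On an initial segment `T` of the half-line, the part above `m` is at most the mean of
`t / (2 m)`. -/
theorem volume_inter_Ici_le_lintegral {T : Set ℝ} {m : ℝ} (hm : 0 < m) (hbdd : BddAbove T)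
    (hdown : ∀ t ∈ T, ∀ s, 0 ≤ s → s ≤ t → s ∈ T) :
    volume (T ∩ Set.Ici m) ≤ ∫⁻ t in T, ENNReal.ofReal (t / (2 * m)) := by
  rcases (T ∩ Set.Ici m).eq_empty_or_nonempty with he | ⟨t₀, ht₀, hmt₀⟩
  · simp [he]
  set Z := sSup T with hZ
  have hmZ : m ≤ Z := le_trans hmt₀ (le_csSup hbdd ht₀)
  have hsub : T ∩ Set.Ici m ⊆ Set.Icc m Z := fun t ht => ⟨ht.2, le_csSup hbdd ht.1⟩
  have hsup : Set.Ioo 0 Z ⊆ T := by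
    intro s hs
    obtain ⟨t, ht, hst⟩ := exists_lt_of_lt_csSup ⟨t₀, ht₀⟩ hs.2
    exact hdown t ht s hs.1.le hst.le
  have hint : ∫ t in Set.Ioo 0 Z, t / (2 * m) = Z ^ 2 / (4 * m) := by
    rw [← integral_Ioc_eq_integral_Ioo, ← intervalIntegral.integral_of_le (hm.le.trans hmZ),
      intervalIntegral.integral_div, integral_id]
    field_simp
    ring
  calc volume (T ∩ Set.Ici m) ≤ volume (Set.Icc m Z) := measure_mono hsub
    _ = ENNReal.ofReal (Z - m) := Real.volume_Icc
    _ ≤ ENNReal.ofReal (Z ^ 2 / (4 * m)) := by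
        refine ENNReal.ofReal_le_ofReal ?_
        rw [le_div_iff₀ (by positivity)]
        -- `Z - m ≤ Z ^ 2 / (4 * m)` is `(Z - 2 * m) ^ 2 ≥ 0`, and the right-hand side is the
        -- integral of `t / (2 * m)` over `(0, Z)`.
        nlinarith [sq_nonneg (Z - 2 * m)]
    _ = ∫⁻ t in Set.Ioo 0 Z, ENNReal.ofReal (t / (2 * m)) := by
        rw [← hint]
        refine ofReal_integral_eq_lintegral_ofReal ?_ ?_
        · exact (Continuous.integrableOn_Icc (by fun_prop)).mono_set Set.Ioo_subset_Icc_self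
        · refine (ae_restrict_iff' measurableSet_Ioo).2 (Filter.Eventually.of_forall ?_)
          intro t ht
          have := ht.1.le
          positivity
    _ ≤ ∫⁻ t in T, ENNReal.ofReal (t / (2 * m)) := lintegral_mono_set hsup

variable {n : ℕ}

/-- Fubini in direction `y`: each fibre is an initial segment of the half-line, so the
one-dimensional inequality applies fibrewise. -/
theorem volume_inter_le_lintegral_coord {S : Set (Fin n → ℝ)} {m : ℝ} {y : Fin n} (hm : 0 < m)
    (hS : MeasurableSet S) (hcube : S ⊆ Set.Icc 0 1)
    (hdown : ∀ w ∈ S, ∀ w', 0 ≤ w' → w' ≤ w → w' ∈ S) :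
    volume (S ∩ {w | m ≤ w y}) ≤ ∫⁻ w in S, ENNReal.ofReal (w y / (2 * m)) := by
  have hmeas : MeasurableSet {w : Fin n → ℝ | m ≤ w y} :=
    measurableSet_le measurable_const (measurable_pi_apply y)
  have hSm : MeasurableSet (S ∩ {w | m ≤ w y}) := hS.inter hmeas
  rw [← lintegral_indicator_one hSm, ← lintegral_indicator hS]
  have hf : Measurable ((S ∩ {w | m ≤ w y}).indicator (1 : (Fin n → ℝ) → ENNReal)) :=
    measurable_one.indicator hSm
  have hg : Measurable (S.indicator fun w : Fin n → ℝ => ENNReal.ofReal (w y / (2 * m))) := by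
    refine Measurable.indicator ?_ hS
    exact ((measurable_pi_apply y).div_const _).ennreal_ofReal
  refine lintegral_le_of_lmarginal_le (μ := fun _ : Fin n => (volume : Measure ℝ)) {y} hf hg ?_
  intro x
  rw [lmarginal_singleton, lmarginal_singleton]
  set T : Set ℝ := {t | Function.update x y t ∈ S} with hT
  have hTm : MeasurableSet T := measurable_update x hS
  have h1 : ∀ t, (S ∩ {w | m ≤ w y}).indicator (1 : (Fin n → ℝ) → ENNReal)
      (Function.update x y t) = (T ∩ Set.Ici m).indicator 1 t := by
    intro t
    by_cases h : Function.update x y t ∈ S <;> by_cases h' : m ≤ t <;> simp [hT, h, h']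
  have h2 : ∀ t, S.indicator (fun w : Fin n → ℝ => ENNReal.ofReal (w y / (2 * m)))
      (Function.update x y t) = T.indicator (fun t => ENNReal.ofReal (t / (2 * m))) t := by
    intro t
    by_cases h : Function.update x y t ∈ S <;> simp [hT, h]
  simp only [h1, h2]
  rw [lintegral_indicator_one (hTm.inter measurableSet_Ici), lintegral_indicator hTm]
  refine volume_inter_Ici_le_lintegral hm ⟨1, fun t ht => ?_⟩ fun t ht s hs hst => ?_
  · simpa using (hcube ht).2 y
  · refine hdown _ ht _ (fun j => ?_) fun j => ?_
    · rcases eq_or_ne j y with rfl | hj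
      · simpa using hs
      · simpa [hj] using (hcube ht).1 j
    · rcases eq_or_ne j y with rfl | hj
      · simpa using hst
      · simp [hj]

theorem integrableOn_of_subset_cube {S : Set (Fin n → ℝ)} (hcube : S ⊆ Set.Icc 0 1)
    {f : (Fin n → ℝ) → ℝ} (hf : Continuous f) : IntegrableOn f S :=
  (hf.continuousOn.integrableOn_compact isCompact_Icc).mono_set hcube

theorem volume_ne_top_of_subset_cube {S : Set (Fin n → ℝ)} (hcube : S ⊆ Set.Icc 0 1) :
    volume S ≠ ⊤ :=
  ((measure_mono hcube).trans_lt isCompact_Icc.measure_lt_top).ne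

/-- A cut of a downward closed set through its mean removes at least half of the volume. -/
theorem volume_inter_le_half {S : Set (Fin n → ℝ)} {m : ℝ} {y : Fin n} (hm : 0 < m)
    (hS : MeasurableSet S) (hcube : S ⊆ Set.Icc 0 1)
    (hdown : ∀ w ∈ S, ∀ w', 0 ≤ w' → w' ≤ w → w' ∈ S)
    (hmean : ∫ w in S, w y ≤ m * volume.real S) :
    volume.real (S ∩ {w | m ≤ w y}) ≤ 1 / 2 * volume.real S := by
  have hpos : 0 ≤ᵐ[volume.restrict S] fun w : Fin n → ℝ => w y / (2 * m) := by
    refine (ae_restrict_iff' hS).2 (Filter.Eventually.of_forall fun w hw => ?_)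
    exact div_nonneg ((hcube hw).1 y) (by positivity)
  have h := volume_inter_le_lintegral_coord (y := y) hm hS hcube hdown
  rw [← ofReal_integral_eq_lintegral_ofReal
    (integrableOn_of_subset_cube hcube (by fun_prop)) hpos] at h
  have h2 := ENNReal.toReal_mono ENNReal.ofReal_ne_top h
  rw [ENNReal.toReal_ofReal (integral_nonneg_of_ae hpos), integral_div] at h2
  refine h2.trans ?_
  rw [div_le_iff₀ (by positivity)]
  linarith

/-- If `f ≥ a` on the half-size copy of a convex set at one of its points, then the integral of
`f ≥ 0` is large. -/
theorem le_integral_of_le_on_half {S : Set (Fin n → ℝ)} (hS : MeasurableSet S)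
    (hcube : S ⊆ Set.Icc 0 1) (hconv : Convex ℝ S) {p : Fin n → ℝ} (hp : p ∈ S)
    {f : (Fin n → ℝ) → ℝ} (hf : Continuous f) (hf0 : ∀ w ∈ S, 0 ≤ f w) {a : ℝ}
    (ha : ∀ w ∈ S, a ≤ f (AffineMap.homothety p (1 / 2 : ℝ) w)) :
    a * ((1 / 2) ^ n * volume.real S) ≤ ∫ w in S, f w := by
  set H : Set (Fin n → ℝ) := AffineMap.homothety p (1 / 2 : ℝ) '' S with hH
  have hHS : H ⊆ S := by
    rintro _ ⟨w, hw, rfl⟩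
    rw [AffineMap.homothety_eq_lineMap]
    exact hconv.lineMap_mem hp hw ⟨by norm_num, by norm_num⟩
  have hvol : volume.real H = (1 / 2) ^ n * volume.real S := by
    have h := Measure.addHaar_image_homothety (volume : Measure (Fin n → ℝ)) p (1 / 2) S
    rw [Measure.real, hH, h, ENNReal.toReal_mul, Measure.real]
    congr 1
    rw [ENNReal.toReal_ofReal (abs_nonneg _)]
    simp
  have hHm : NullMeasurableSet H := by
    have hc : Convex ℝ H := hconv.affine_image _
    exact hc.nullMeasurableSet volume
  have hHfin := volume_ne_top_of_subset_cube (hHS.trans hcube)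
  calc a * ((1 / 2) ^ n * volume.real S) = ∫ _ in H, a := by
        rw [setIntegral_const, smul_eq_mul, hvol, mul_comm]
    _ ≤ ∫ w in H, f w := by
        refine setIntegral_mono_on₀ (integrableOn_const hHfin)
          (integrableOn_of_subset_cube (hHS.trans hcube) hf) hHm ?_
        rintro _ ⟨w, hw, rfl⟩
        exact ha w hw
    _ ≤ ∫ w in S, f w := by
        refine setIntegral_mono_set (integrableOn_of_subset_cube hcube hf) ?_
          (Filter.Eventually.of_forall hHS)
        exact (ae_restrict_iff' hS).2 (Filter.Eventually.of_forall hf0)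

/-! ### The potential set of the main loop -/

namespace SecurityGame

/-- The points `w ≥ 0` such that `lo` can be raised by `w` in the coordinates in `A`; the other
coordinates are at most `κ`. Its volume is the potential of the main loop of `Clinch`. -/
def thickened (G : SecurityGame n) (A : Set (Fin n)) (κ : ℝ) (lo : Fin n → ℝ) :
    Set (Fin n → ℝ) :=
  {w | 0 ≤ w ∧ (∀ j, j ∉ A → w j ≤ κ) ∧ lo + A.indicator w ∈ G.X}

variable {G : SecurityGame n} {A A' : Set (Fin n)} {κ η : ℝ} {lo : Fin n → ℝ} {y : Fin n}

theorem thickened_isClosed : IsClosed (G.thickened A κ lo) := by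
  have hcont : Continuous fun w : Fin n → ℝ => lo + A.indicator w := by
    refine continuous_const.add (continuous_pi fun j => ?_)
    by_cases hj : j ∈ A
    · simpa [hj] using continuous_apply j
    · simpa [hj] using continuous_const
  have h1 : IsClosed {w : Fin n → ℝ | 0 ≤ w} := isClosed_Ici
  have h2 : IsClosed {w : Fin n → ℝ | ∀ j, j ∉ A → w j ≤ κ} := by
    simp only [Set.ofPred_forall]
    exact isClosed_iInter fun j => isClosed_iInter fun _ =>
      isClosed_le (continuous_apply j) continuous_const
  exact h1.inter (h2.inter (G.isClosed.preimage hcont))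

theorem thickened_convex : Convex ℝ (G.thickened A κ lo) := by
  intro w hw z hz s t hs ht hst
  refine ⟨add_nonneg (smul_nonneg hs hw.1) (smul_nonneg ht hz.1), fun j hj => ?_, ?_⟩
  · have h1 := mul_le_mul_of_nonneg_left (hw.2.1 j hj) hs
    have h2 := mul_le_mul_of_nonneg_left (hz.2.1 j hj) ht
    have : s * κ + t * κ = κ := by rw [← add_mul, hst, one_mul]
    simp only [Pi.add_apply, Pi.smul_apply, smul_eq_mul]
    linarith
  · have := G.convex hw.2.2 hz.2.2 hs ht hst
    convert this using 1
    funext j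
    by_cases hj : j ∈ A <;> simp [hj] <;> linear_combination -(lo j) * hst

theorem thickened_subset_cube (hlo : 0 ≤ lo) (hκ : κ ≤ 1) :
    G.thickened A κ lo ⊆ Set.Icc 0 1 := by
  intro w hw
  refine ⟨hw.1, fun j => ?_⟩
  by_cases hj : j ∈ A
  · have h1 := (G.coord_mem hw.2.2 j).2
    have h2 : (0 : ℝ) ≤ lo j := hlo j
    simp only [Pi.add_apply, Set.indicator_of_mem hj] at h1
    simp only [Pi.one_apply]
    linarith
  · exact (hw.2.1 j hj).trans hκ

theorem thickened_downward_closed (hlo : 0 ≤ lo) :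
    ∀ w ∈ G.thickened A κ lo, ∀ w', 0 ≤ w' → w' ≤ w → w' ∈ G.thickened A κ lo := by
  intro w hw w' h0 hle
  refine ⟨h0, fun j hj => (hle j).trans (hw.2.1 j hj), G.downward_closed _ hw.2.2 _ ?_ ?_⟩
  · exact add_nonneg hlo (Set.indicator_nonneg fun j _ => h0 j)
  · exact add_le_add_right (fun j => Set.indicator_le_indicator (hle j)) lo

/-- If each active coordinate of `lo` can be raised by `η`, then all of them can be raised by
`η / n` at the same time. -/
theorem add_indicator_mem (hlo : 0 ≤ lo) (hloX : lo ∈ G.X)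
    (hext : ∀ j ∈ A, lo + Pi.single j η ∈ G.X) {t : Fin n → ℝ} (ht0 : 0 ≤ t)
    (ht : ∀ j ∈ A, t j ≤ η / n) : lo + A.indicator t ∈ G.X := by
  classical
  rcases Nat.eq_zero_or_pos n with rfl | hn
  · convert hloX
  have hn' : (0 : ℝ) < n := by exact_mod_cast hn
  have hmem : ∑ j : Fin n, (1 / n : ℝ) • (lo + Pi.single j (A.indicator (fun _ => η) j))
      ∈ G.X := by
    refine G.convex.sum_mem (fun _ _ => by positivity) (by simp [hn'.ne']) fun j _ => ?_
    by_cases hj : j ∈ A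
    · simpa [hj] using hext j hj
    · simpa [hj] using hloX
  refine G.downward_closed _ hmem _
    (add_nonneg hlo (Set.indicator_nonneg fun j _ => ht0 j)) fun k => ?_
  have : (∑ j : Fin n, (1 / n : ℝ) • (lo + Pi.single j (A.indicator (fun _ => η) j)) :
        Fin n → ℝ) k
      = lo k + A.indicator (fun _ => η / n) k := by
    simp only [Finset.sum_apply, Pi.smul_apply, Pi.add_apply, smul_eq_mul, mul_add,
      Finset.sum_add_distrib]
    have hs : ∑ j, (1 / n : ℝ) * (Pi.single j (A.indicator (fun _ => η) j) : Fin n → ℝ) k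
        = (1 / n : ℝ) * A.indicator (fun _ => η) k := by
      rw [Finset.sum_eq_single k (fun j _ hj => by simp [hj.symm]) (by simp)]
      simp
    rw [hs]
    by_cases hk : k ∈ A
    · simp [hk, hn'.ne']; field_simp
    · simp [hk, hn'.ne']
  rw [this, Pi.add_apply]
  refine add_le_add_right ?_ _
  by_cases hk : k ∈ A
  · simpa [hk] using ht k hk
  · simp [hk]

/-- The set contains the whole cube of side `κ`, since the active coordinates can all be raised by
`η / n` at once. -/
theorem pow_le_volume_thickened (hlo : 0 ≤ lo) (hloX : lo ∈ G.X) (hκ : 0 ≤ κ)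
    (hκ1 : κ ≤ 1) (hκη : κ ≤ η / n) (hext : ∀ j ∈ A, lo + Pi.single j η ∈ G.X) :
    κ ^ n ≤ volume.real (G.thickened A κ lo) := by
  have hsub : Set.Icc (0 : Fin n → ℝ) (fun _ => κ) ⊆ G.thickened A κ lo := fun w hw =>
    ⟨hw.1, fun j _ => hw.2 j,
      add_indicator_mem hlo hloX hext hw.1 fun j _ => (hw.2 j).trans hκη⟩
  have hv : volume.real (Set.Icc (0 : Fin n → ℝ) (fun _ => κ)) = κ ^ n := by
    rw [Measure.real, Real.volume_Icc_pi, ENNReal.toReal_prod]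
    simp [ENNReal.toReal_ofReal hκ]
  rw [← hv]
  exact measureReal_mono hsub (volume_ne_top_of_subset_cube (thickened_subset_cube hlo hκ1))

/-- Locking coordinates does not increase the potential. -/
theorem volume_thickened_anti (hlo : 0 ≤ lo) (hloX : lo ∈ G.X) (hη : 0 ≤ η)
    (hκ1 : κ ≤ 1) (hκη : 2 ^ (n + 1) * κ ≤ η / n) (hext : ∀ j ∈ A, lo + Pi.single j η ∈ G.X)
    (hA : A' ⊆ A) :
    volume.real (G.thickened A' κ lo) ≤ volume.real (G.thickened A κ lo) := by
  classical
  rcases hA.eq_or_ssubset with rfl | hss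
  · exact le_rfl
  obtain ⟨j₀, hj₀, hj₀'⟩ := Set.exists_of_ssubset hss
  -- This scaling maps the set after locking into the set before. Halving up to `n - 1` coordinates
  -- is paid for by the factor `2 ^ n` of a newly locked one, so the determinant is at least `1`.
  set D : Fin n → ℝ := fun j => if j ∈ A' then 1 / 2 else if j ∈ A then 2 ^ n else 1 with hD
  set f : (Fin n → ℝ) →ₗ[ℝ] (Fin n → ℝ) := Matrix.toLin' (Matrix.diagonal D) with hf
  have hfw : ∀ w j, f w j = D j * w j := by
    intro w j
    simp [hf, Matrix.mulVec_diagonal]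
  have hD0 : ∀ j, 0 ≤ D j := fun j => by simp only [hD]; split_ifs <;> positivity
  have hdet : 1 ≤ LinearMap.det f := by
    rw [hf, LinearMap.det_toLin', Matrix.det_diagonal,
      ← Finset.mul_prod_erase _ _ (Finset.mem_univ j₀)]
    have h1 : D j₀ = 2 ^ n := by simp [hD, hj₀, hj₀']
    have h2 : (1 / 2 : ℝ) ^ (n - 1) ≤ ∏ j ∈ Finset.univ.erase j₀, D j := by
      calc (1 / 2 : ℝ) ^ (n - 1) = ∏ j ∈ Finset.univ.erase j₀, (1 / 2 : ℝ) := by simp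
        _ ≤ _ := Finset.prod_le_prod (fun _ _ => by norm_num) fun j _ => by
            simp only [hD]
            have : (1 : ℝ) ≤ 2 ^ n := one_le_pow₀ (by norm_num)
            split_ifs <;> linarith
    have h3 : (1 : ℝ) ≤ 2 ^ n * (1 / 2) ^ (n - 1) := by
      calc (1 : ℝ) = 2 ^ n * (1 / 2) ^ n := by rw [← mul_pow]; norm_num
        _ ≤ _ := by
            gcongr 2 ^ n * ?_
            exact pow_le_pow_of_le_one (by norm_num) (by norm_num) (Nat.sub_le _ _)
    rw [h1]
    exact h3.trans (by gcongr)
  have himg : f '' G.thickened A' κ lo ⊆ G.thickened A κ lo := by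
    rintro _ ⟨w, hw, rfl⟩
    refine ⟨fun j => ?_, fun j hj => ?_, ?_⟩
    · rw [hfw]; exact mul_nonneg (hD0 j) (hw.1 j)
    · have hj' : j ∉ A' := fun h => hj (hA h)
      rw [hfw]
      simpa [hD, hj, hj'] using hw.2.1 j hj'
    · have hbox : lo + A.indicator (A'ᶜ.indicator fun j => 2 ^ (n + 1) * w j) ∈ G.X := by
        refine add_indicator_mem hlo hloX hext
          (Set.indicator_nonneg fun j _ => mul_nonneg (by positivity) (hw.1 j)) fun j hj => ?_
        by_cases hj' : j ∈ A'
        · simp only [Set.indicator_of_notMem (fun h : j ∈ A'ᶜ => h hj')]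
          positivity
        · rw [Set.indicator_of_mem (show j ∈ A'ᶜ from hj')]
          exact le_trans (by gcongr; exact hw.2.1 j hj') hκη
      -- The image is the midpoint of a point raised only on `A'` and one raised only on `A \ A'`.
      -- The latter carries `2 ^ (n + 1)` times the locked coordinates, hence the smallness required
      -- of `κ`.
      have := G.convex hw.2.2 hbox (a := 1 / 2) (b := 1 / 2) (by norm_num) (by norm_num)
        (by norm_num)
      convert this using 1
      funext j
      by_cases hj : j ∈ A
      · by_cases hj' : j ∈ A'
        · simp [hfw, hD, hj, hj']; ring
        · simp [hfw, hD, hj, hj']; ring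
      · have hj' : j ∉ A' := fun h => hj (hA h)
        simp [hj, hj']; ring
  have hvol : volume.real (f '' G.thickened A' κ lo)
      = LinearMap.det f * volume.real (G.thickened A' κ lo) := by
    rw [Measure.real, Measure.addHaar_image_linearMap, ENNReal.toReal_mul,
      ENNReal.toReal_ofReal (abs_nonneg _), abs_of_nonneg (by linarith), Measure.real]
  calc volume.real (G.thickened A' κ lo)
      ≤ LinearMap.det f * volume.real (G.thickened A' κ lo) :=
        le_mul_of_one_le_left measureReal_nonneg hdet
    _ = volume.real (f '' G.thickened A' κ lo) := hvol.symm
    _ ≤ _ := measureReal_mono himg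
        (volume_ne_top_of_subset_cube (thickened_subset_cube hlo hκ1))

/-- Raising `lo` in an active coordinate cuts the potential set. -/
theorem volume_thickened_update {m : ℝ} (hm : 0 ≤ m) (hy : y ∈ A) :
    volume.real (G.thickened A κ (Function.update lo y (lo y + m)))
      = volume.real (G.thickened A κ lo ∩ {w | m ≤ w y}) := by
  have : G.thickened A κ (Function.update lo y (lo y + m))
      = (fun w => w + Pi.single y m) ⁻¹' (G.thickened A κ lo ∩ {w | m ≤ w y}) := by
    ext w
    have h1 : Function.update lo y (lo y + m) + A.indicator w
        = lo + A.indicator (w + Pi.single y m) := by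
      funext j
      rcases eq_or_ne j y with rfl | hj
      · simp [hy]; ring
      · by_cases hjA : j ∈ A <;> simp [hj, hjA]
    simp only [thickened, Set.mem_ofPred_eq, Set.mem_preimage, Set.mem_inter_iff, h1]
    constructor
    · rintro ⟨h0, hκ', hX⟩
      have h0y : 0 ≤ w y := h0 y
      refine ⟨⟨add_nonneg h0 (by simpa using hm), fun j hj => ?_, hX⟩, by simpa using h0y⟩
      have hjy : j ≠ y := fun h => hj (h ▸ hy)
      simpa [hjy] using hκ' j hj
    · rintro ⟨⟨h0, hκ', hX⟩, hmy⟩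
      refine ⟨fun j => ?_, fun j hj => ?_, hX⟩
      · rcases eq_or_ne j y with rfl | hj
        · simpa using hmy
        · simpa [hj] using h0 j
      · have hjy : j ≠ y := fun h => hj (h ▸ hy)
        simpa [hjy] using hκ' j hj
  rw [this, Measure.real, measure_preimage_add_right, Measure.real]

/-- The mean of the coordinates over the potential set. -/
def thickenedMean (G : SecurityGame n) (A : Set (Fin n)) (κ : ℝ) (lo : Fin n → ℝ) (j : Fin n) : ℝ :=
  (∫ w in G.thickened A κ lo, w j) / volume.real (G.thickened A κ lo)

theorem single_mem_thickened (hη : 0 ≤ η) (hκ : 0 ≤ κ) (hy : y ∈ A)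
    (hext : lo + Pi.single y η ∈ G.X) : Pi.single y η ∈ G.thickened A κ lo := by
  refine ⟨by simpa using hη, fun j hj => ?_, ?_⟩
  · have hjy : j ≠ y := fun h => hj (h ▸ hy)
    simpa [hjy] using hκ
  · convert hext using 2
    funext j
    by_cases hj : j ∈ A
    · simp [hj]
    · have hjy : j ≠ y := fun h => hj (h ▸ hy)
      simp [hj, hjy]

/-- The half-size copy of the set at its point `Pi.single y η` has a `2 ^ n`-th of the volume, and
there coordinate `y` is at least `η / 2`. -/
theorem le_thickenedMean (hlo : 0 ≤ lo) (hη : 0 ≤ η) (hκ : 0 ≤ κ) (hκ1 : κ ≤ 1)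
    (hvol : 0 < volume.real (G.thickened A κ lo)) (hy : y ∈ A)
    (hext : lo + Pi.single y η ∈ G.X) :
    η / 2 * (1 / 2) ^ n ≤ G.thickenedMean A κ lo y := by
  rw [thickenedMean, le_div_iff₀ hvol, mul_assoc]
  refine le_integral_of_le_on_half thickened_isClosed.measurableSet
    (thickened_subset_cube hlo hκ1) thickened_convex (single_mem_thickened hη hκ hy hext)
    (continuous_apply y) (fun w hw => hw.1 y) fun w hw => ?_
  have : (0 : ℝ) ≤ w y := hw.1 y
  simp [AffineMap.homothety_apply]
  linarith

/-- Room remains above the mean: on the half-size copy at `0`, coordinate `y` stays below its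
maximum `h` by at least `h / 2`, and `h ≥ η`. This preserves the extent of a coordinate that has
just been raised. -/
theorem add_single_thickenedMean_mem (hlo : 0 ≤ lo) (hη : 0 ≤ η) (hκ : 0 ≤ κ) (hκ1 : κ ≤ 1)
    (hvol : 0 < volume.real (G.thickened A κ lo)) (hy : y ∈ A) (hloX : lo ∈ G.X)
    (hext : lo + Pi.single y η ∈ G.X) :
    lo + Pi.single y (G.thickenedMean A κ lo y + η / 2 * (1 / 2) ^ n) ∈ G.X := by
  have hcube := thickened_subset_cube (G := G) (A := A) hlo hκ1
  have hcomp : IsCompact (G.thickened A κ lo) :=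
    isCompact_Icc.of_isClosed_subset thickened_isClosed hcube
  have h0mem : (0 : Fin n → ℝ) ∈ G.thickened A κ lo := by
    simpa using single_mem_thickened (η := 0) (y := y) le_rfl hκ hy (by simpa using hloX)
  obtain ⟨p, hp, hmax⟩ := hcomp.exists_isMaxOn ⟨0, h0mem⟩ (continuous_apply y).continuousOn
  set h := p y with hh
  have hle : ∀ w ∈ G.thickened A κ lo, w y ≤ h := fun w hw => hmax hw
  have hηh : η ≤ h := by simpa using hle _ (single_mem_thickened hη hκ hy hext)
  have hint := le_integral_of_le_on_half (a := h / 2) thickened_isClosed.measurableSet hcube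
    thickened_convex h0mem (f := fun w => h - w y) (by fun_prop)
    (fun w hw => sub_nonneg.2 (hle w hw)) fun w hw => by
      have := hle w hw
      simp [AffineMap.homothety_apply]
      linarith
  rw [integral_sub (integrableOn_of_subset_cube hcube continuous_const)
    (integrableOn_of_subset_cube hcube (continuous_apply y)), setIntegral_const,
    smul_eq_mul] at hint
  have hpw : (0 : ℝ) < (1 / 2) ^ n := by positivity
  have hm : G.thickenedMean A κ lo y + η / 2 * (1 / 2) ^ n ≤ h := by
    have : G.thickenedMean A κ lo y ≤ h - h / 2 * (1 / 2) ^ n := by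
      rw [thickenedMean, div_le_iff₀ hvol]
      linarith
    nlinarith
  have hm0 : 0 ≤ G.thickenedMean A κ lo y + η / 2 * (1 / 2) ^ n := by
    have := le_thickenedMean hlo hη hκ hκ1 hvol hy hext
    have h2 : 0 ≤ η / 2 * (1 / 2) ^ n := by positivity
    linarith
  refine G.downward_closed _ hp.2.2 _ (add_nonneg hlo (by simpa using hm0)) fun j => ?_
  refine add_le_add_right ?_ _
  rcases eq_or_ne j y with rfl | hj
  · simpa [hy] using hm
  · simpa [hj] using Set.indicator_nonneg (fun j _ => hp.1 j) j

theorem volume_thickened_update_le_half (hlo : 0 ≤ lo) (hκ1 : κ ≤ 1) (hy : y ∈ A)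
    (hvol : 0 < volume.real (G.thickened A κ lo)) (hm : 0 < G.thickenedMean A κ lo y) :
    volume.real (G.thickened A κ (Function.update lo y (lo y + G.thickenedMean A κ lo y)))
      ≤ 1 / 2 * volume.real (G.thickened A κ lo) := by
  rw [volume_thickened_update hm.le hy]
  refine volume_inter_le_half hm thickened_isClosed.measurableSet (thickened_subset_cube hlo hκ1)
    (thickened_downward_closed hlo) ?_
  rw [thickenedMean, div_mul_cancel₀ _ hvol.ne']

end SecurityGame

/-! ### Faces, their Hausdorff measure and their centroid -/

open Classical in
/-- Raise the coordinates in `A` of `lo` by `v`. -/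
def raise (A : Set (Fin n)) (lo : Fin n → ℝ) (v : A → ℝ) : Fin n → ℝ :=
  fun j => if h : j ∈ A then lo j + v ⟨j, h⟩ else lo j

section raise

variable {A : Set (Fin n)} {lo : Fin n → ℝ} {v : A → ℝ} {j : Fin n}

theorem raise_of_mem (h : j ∈ A) : raise A lo v j = lo j + v ⟨j, h⟩ := by simp [raise, h]

theorem raise_of_notMem (h : j ∉ A) : raise A lo v j = lo j := by simp [raise, h]

theorem raise_restrict {w : Fin n → ℝ} :
    raise A lo (fun j : A => w j) = lo + A.indicator w := by
  funext j
  by_cases h : j ∈ A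
  · simp [raise_of_mem h, h]
  · simp [raise_of_notMem h, h]

theorem continuous_raise : Continuous (raise A lo) := by
  refine continuous_pi fun j => ?_
  by_cases h : j ∈ A
  · simp only [raise_of_mem h]; fun_prop
  · simp only [raise_of_notMem h]; fun_prop

/-- In the sup metric the embedding preserves distances, and Hausdorff measure for this metric is
Lebesgue measure on `A → ℝ`; so measure on the face can be pulled back. -/
theorem isometry_raise [Fintype A] : Isometry (raise A lo) := by
  refine Isometry.of_dist_eq fun v w => le_antisymm ?_ ?_
  · refine (dist_pi_le_iff dist_nonneg).2 fun j => ?_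
    by_cases h : j ∈ A
    · rw [raise_of_mem h, raise_of_mem h, dist_add_left]
      exact dist_le_pi_dist v w ⟨j, h⟩
    · rw [raise_of_notMem h, raise_of_notMem h, dist_self]
      exact dist_nonneg
  · refine (dist_pi_le_iff dist_nonneg).2 fun j => ?_
    refine le_trans ?_ (dist_le_pi_dist (raise A lo v) (raise A lo w) j)
    rw [raise_of_mem j.2, raise_of_mem j.2, dist_add_left]

end raise

namespace SecurityGame

/-- The strategies that agree with `lo` off `A` and are at least `lo` on `A`. -/
def face (G : SecurityGame n) (A : Set (Fin n)) (lo : Fin n → ℝ) : Set (Fin n → ℝ) :=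
  {z | z ∈ G.X ∧ lo ≤ z ∧ ∀ j, j ∉ A → z j = lo j}

/-- The face in its own coordinates. -/
def faceCoords (G : SecurityGame n) (A : Set (Fin n)) (lo : Fin n → ℝ) : Set (A → ℝ) :=
  {v | 0 ≤ v ∧ raise A lo v ∈ G.X}

variable {G : SecurityGame n} {A : Set (Fin n)} {κ η : ℝ} {lo : Fin n → ℝ} {y : Fin n}

theorem face_isClosed : IsClosed (G.face A lo) := by
  have h2 : IsClosed {z : Fin n → ℝ | ∀ j, j ∉ A → z j = lo j} := by
    simp only [Set.ofPred_forall]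
    exact isClosed_iInter fun j => isClosed_iInter fun _ =>
      isClosed_eq (continuous_apply j) continuous_const
  exact G.isClosed.inter (isClosed_Ici.inter h2)

theorem face_convex : Convex ℝ (G.face A lo) := by
  intro w hw z hz s t hs ht hst
  refine ⟨G.convex hw.1 hz.1 hs ht hst, convex_Ici lo hw.2.1 hz.2.1 hs ht hst, fun j hj => ?_⟩
  simp only [Pi.add_apply, Pi.smul_apply, smul_eq_mul, hw.2.2 j hj, hz.2.2 j hj]
  rw [← add_mul, hst, one_mul]

theorem image_raise_faceCoords : raise A lo '' G.faceCoords A lo = G.face A lo := by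
  ext z
  constructor
  · rintro ⟨v, hv, rfl⟩
    refine ⟨hv.2, fun j => ?_, fun j hj => raise_of_notMem hj⟩
    by_cases h : j ∈ A
    · rw [raise_of_mem h]
      exact le_add_of_nonneg_right (hv.1 _)
    · rw [raise_of_notMem h]
  · rintro ⟨hzX, hlo, hz⟩
    have : raise A lo (fun j : A => z j - lo j) = z := by
      funext j
      by_cases h : j ∈ A
      · rw [raise_of_mem h]; ring
      · rw [raise_of_notMem h, hz j h]
    refine ⟨fun j : A => z j - lo j, ⟨fun j => sub_nonneg.2 (hlo j), ?_⟩, this⟩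
    rwa [this]

/-- The direction space is the coordinate subspace of `A`: each basis vector is a multiple of the
difference of `lo + Pi.single j η` and `lo`. -/
theorem finrank_vectorSpan_face [Fintype A] (hη : 0 < η) (hloX : lo ∈ G.X)
    (hext : ∀ j ∈ A, lo + Pi.single j η ∈ G.X) :
    Module.finrank ℝ (vectorSpan ℝ (G.face A lo)) = Fintype.card A := by
  classical
  set E : (A → ℝ) →ₗ[ℝ] (Fin n → ℝ) := Function.ExtendByZero.linearMap ℝ Subtype.val with hE
  have hEinj : Function.Injective E := by
    intro v w hvw
    funext j
    have := congrFun hvw j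
    simpa [hE, Subtype.val_injective.extend_apply] using this
  have hEs : ∀ j : A, E (Pi.single j 1) = Pi.single (j : Fin n) 1 := by
    intro j
    funext k
    by_cases hk : k ∈ A
    · have := Subtype.val_injective.extend_apply (Pi.single j (1 : ℝ)) (0 : Fin n → ℝ) ⟨k, hk⟩
      simp only [hE, Function.ExtendByZero.linearMap_apply] at this ⊢
      rw [this]
      simp [Pi.single_apply, Subtype.ext_iff]
    · have hkj : k ≠ j := fun h => hk (h ▸ j.2)
      have h0 : ¬ ∃ a : A, (a : Fin n) = k := fun ⟨a, ha⟩ => hk (ha ▸ a.2)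
      simp [hE, Function.extend_apply' _ _ _ h0, hkj]
  have hspan : vectorSpan ℝ (G.face A lo) = LinearMap.range E := by
    have hlof : lo ∈ G.face A lo := ⟨hloX, le_rfl, fun _ _ => rfl⟩
    apply le_antisymm
    · rw [vectorSpan_def, Submodule.span_le]
      rintro _ ⟨z, hz, z', hz', rfl⟩
      refine ⟨fun j => z j - z' j, ?_⟩
      funext k
      by_cases hk : k ∈ A
      · have := Subtype.val_injective.extend_apply (fun j : A => z j - z' j)
          (0 : Fin n → ℝ) ⟨k, hk⟩
        simpa [hE] using this
      · have h0 : ¬ ∃ a : A, (a : Fin n) = k := fun ⟨a, ha⟩ => hk (ha ▸ a.2)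
        simp [hE, Function.extend_apply' _ _ _ h0, hz.2.2 k hk, hz'.2.2 k hk]
    · rintro _ ⟨v, rfl⟩
      rw [LinearMap.pi_apply_eq_sum_univ E v]
      refine Submodule.sum_mem _ fun j _ => Submodule.smul_mem _ _ ?_
      have h1 : lo + Pi.single (j : Fin n) η ∈ G.face A lo := by
        refine ⟨hext j j.2, le_add_of_nonneg_right (by simpa using hη.le), fun k hk => ?_⟩
        have hkj : k ≠ j := fun h => hk (h ▸ j.2)
        simp [hkj]
      have h2 := vsub_mem_vectorSpan ℝ h1 hlof
      have h3 : E (fun i => if j = i then 1 else 0)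
          = η⁻¹ • ((lo + Pi.single (j : Fin n) η) -ᵥ lo) := by
        have : (fun i => if j = i then (1 : ℝ) else 0) = Pi.single j 1 := by
          funext i; simp [Pi.single_apply, eq_comm]
        rw [this, hEs, vsub_eq_sub, add_sub_cancel_left, ← Pi.single_smul]
        simp [hη.ne']
      rw [h3]
      exact Submodule.smul_mem _ _ h2
  rw [hspan, LinearMap.finrank_range_of_inj hEinj, Module.finrank_fintype_fun_eq_card]

theorem restrict_face_eq_map [Fintype A] :
    (Measure.hausdorffMeasure (Fintype.card A : ℝ)).restrict (G.face A lo)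
      = (volume.restrict (G.faceCoords A lo)).map (raise A lo) := by
  have hemb : MeasurableEmbedding (raise A lo) :=
    isometry_raise.isClosedEmbedding.measurableEmbedding
  have hmap := isometry_raise (A := A) (lo := lo).map_hausdorffMeasure
    (d := (Fintype.card A : ℝ)) (Or.inl (by positivity))
  rw [hausdorffMeasure_pi_real] at hmap
  have hsub : G.face A lo ⊆ Set.range (raise A lo) := by
    rw [← image_raise_faceCoords]; exact Set.image_subset_range _ _
  rw [← Measure.restrict_restrict_of_subset hsub, ← hmap, hemb.restrict_map]
  congr 2
  rw [← image_raise_faceCoords, Set.preimage_image_eq _ hemb.injective]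

open Classical in
/-- Integrals over the potential set of functions of the coordinates in `A`. -/
theorem setIntegral_thickened (g : (A → ℝ) → ℝ) :
    ∫ w in G.thickened A κ lo, g (fun j : A => w j)
      = (∫ v in G.faceCoords A lo, g v) *
        volume.real (Set.Icc (0 : {j // ¬ j ∈ A} → ℝ) fun _ => κ) := by
  set ψ := MeasurableEquiv.piEquivPiSubtypeProd (fun _ : Fin n => ℝ) (· ∈ A) with hψ
  have hψp : MeasurePreserving ψ :=
    volume_preserving_piEquivPiSubtypeProd (fun _ : Fin n => ℝ) (· ∈ A)
  -- Splitting the coordinates into `A` and its complement turns the potential set into a product,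
  -- so the box factor cancels in means.
  have hpre : G.thickened A κ lo
      = ψ ⁻¹' (G.faceCoords A lo ×ˢ Set.Icc (0 : {j // ¬ j ∈ A} → ℝ) fun _ => κ) := by
    ext w
    have h1 : (ψ w).1 = fun j : A => w j := rfl
    have h2 : (ψ w).2 = fun j : {j // ¬ j ∈ A} => w j := rfl
    simp only [thickened, faceCoords, Set.mem_preimage, Set.mem_prod, Set.mem_Icc, h1, h2,
      Set.mem_ofPred_eq, raise_restrict]
    constructor
    · rintro ⟨h0, hκ, hX⟩
      exact ⟨⟨fun j => h0 j, hX⟩, fun j => h0 j, fun j => hκ j j.2⟩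
    · rintro ⟨⟨h0, hX⟩, h0', hκ⟩
      refine ⟨fun j => ?_, fun j hj => hκ ⟨j, hj⟩, hX⟩
      by_cases hj : j ∈ A
      · exact h0 ⟨j, hj⟩
      · exact h0' ⟨j, hj⟩
  have h := hψp.setIntegral_preimage_emb ψ.measurableEmbedding (fun p => g p.1 * 1)
    (G.faceCoords A lo ×ˢ Set.Icc (0 : {j // ¬ j ∈ A} → ℝ) fun _ => κ)
  rw [← hpre, Measure.volume_eq_prod,
    setIntegral_prod_mul g (fun _ => (1 : ℝ)) (G.faceCoords A lo) _] at h
  simpa [hψ] using h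

theorem volume_thickened_eq [DecidablePred (· ∈ A)] :
    volume.real (G.thickened A κ lo) = volume.real (G.faceCoords A lo) *
      volume.real (Set.Icc (0 : {j // ¬ j ∈ A} → ℝ) fun _ => κ) := by
  classical
  have := setIntegral_thickened (G := G) (A := A) (κ := κ) (lo := lo) fun _ => 1
  simp only [setIntegral_const, smul_eq_mul, mul_one] at this
  convert this

theorem integrable_faceCoords [Fintype A] {f : (A → ℝ) → ℝ} (hf : Continuous f)
    (hlo : 0 ≤ lo) : IntegrableOn f (G.faceCoords A lo) := by
  refine (hf.continuousOn.integrableOn_compact (isCompact_Icc (a := 0) (b := 1))).mono_set ?_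
  intro v hv
  refine ⟨hv.1, fun j => ?_⟩
  have h1 := (G.coord_mem hv.2 j).2
  have h2 : (0 : ℝ) ≤ lo j := hlo j
  rw [raise_of_mem j.2] at h1
  simp only [Pi.one_apply]
  linarith

/-- The centroid of a face is described by the means over the potential set. -/
theorem centroid_face (hlo : 0 ≤ lo) (hη : 0 < η) (hloX : lo ∈ G.X)
    (hext : ∀ j ∈ A, lo + Pi.single j η ∈ G.X) (hvol : 0 < volume.real (G.thickened A κ lo)) :
    Clinch.centroid (G.face A lo) ∈ G.face A lo ∧
      ∀ y ∈ A, Clinch.centroid (G.face A lo) y = lo y + G.thickenedMean A κ lo y := by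
  classical
  set T := G.faceCoords A lo with hT
  have hbox0 := hvol
  rw [volume_thickened_eq] at hbox0
  have hTpos : 0 < volume.real T := by
    by_contra h
    have h1 : volume.real T = 0 := le_antisymm (not_lt.1 h) measureReal_nonneg
    rw [← hT, h1, zero_mul] at hbox0
    exact lt_irrefl _ hbox0
  have hbox : (0 : ℝ) < volume.real (Set.Icc (0 : {j // ¬ j ∈ A} → ℝ) fun _ => κ) :=
    (pos_iff_pos_of_mul_pos hbox0).1 hTpos
  have hemb : MeasurableEmbedding (raise A lo) :=
    isometry_raise.isClosedEmbedding.measurableEmbedding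
  have hTtop : volume T ≠ ⊤ := fun h => by simp [Measure.real, h] at hTpos
  have hraise : IntegrableOn (raise A lo) T := by
    refine Integrable.of_eval fun j => ?_
    exact integrable_faceCoords ((continuous_apply j).comp continuous_raise) hlo
  have hid : IntegrableOn (fun x : Fin n → ℝ => x) (G.face A lo)
      (Measure.hausdorffMeasure (Fintype.card A : ℝ)) := by
    rw [IntegrableOn, restrict_face_eq_map, hemb.integrable_map_iff]
    exact hraise
  have hμ : Measure.hausdorffMeasure (Fintype.card A : ℝ) (G.face A lo) = volume T := by
    rw [← Measure.restrict_apply_univ, restrict_face_eq_map, hemb.map_apply]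
    simp [hT]
  have hT0 : volume T ≠ 0 := fun h => by simp [Measure.real, h] at hTpos
  rw [Clinch.centroid, finrank_vectorSpan_face hη hloX hext]
  refine ⟨face_convex.set_average_mem face_isClosed (by rwa [hμ]) (by rwa [hμ]) ?_ hid,
    fun y hy => ?_⟩
  · exact (ae_restrict_iff' face_isClosed.measurableSet).2 (Filter.Eventually.of_forall
      fun _ h => h)
  · rw [setAverage_eq, Measure.real, hμ, Pi.smul_apply, smul_eq_mul, eval_integral
      (fun j => (hid.eval j)), restrict_face_eq_map, hemb.integral_map]
    have h1 : ∫ v in T, raise A lo v y = lo y * volume.real T + ∫ v in T, v ⟨y, hy⟩ := by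
      simp only [raise_of_mem hy]
      rw [integral_add (integrable_faceCoords continuous_const hlo)
        (integrable_faceCoords (continuous_apply _) hlo), setIntegral_const, smul_eq_mul, mul_comm]
    have h2 := setIntegral_thickened (G := G) (A := A) (κ := κ) (lo := lo) fun v => v ⟨y, hy⟩
    rw [h1, thickenedMean, volume_thickened_eq, h2, ← hT]
    rw [Measure.real] at hTpos ⊢
    field_simp

end SecurityGame

/-! ### Termination of loops -/

namespace Clinch

/-- A loop with an invariant `P` that counts iterations and excludes the loop condition after `N`
of them. -/
theorem exists_mem_whileLoop {σ : Type} {cond : σ → Prop} {body : σ → σ} {s : σ}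
    (P : ℕ → σ → Prop) {N : ℕ} (h0 : P 0 s)
    (hstep : ∀ k t, P k t → cond t → P (k + 1) (body t)) (hN : ∀ t, P N t → ¬ cond t) :
    ∃ t ∈ whileLoop cond body s, ∃ k ≤ N, P k t ∧ ¬ cond t := by
  classical
  have hP : ∀ k, (∀ i < k, cond (body^[i] s)) → P k (body^[k] s) := by
    intro k
    induction k with
    | zero => intro _; exact h0
    | succ k ih =>
      intro hk
      rw [Function.iterate_succ_apply']
      exact hstep _ _ (ih fun i hi => hk i (by omega)) (hk k (by omega))
  have hex : ∃ k ≤ N, ¬ cond (body^[k] s) := by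
    by_contra! hall
    exact hN _ (hP N fun i hi => hall i hi.le) (hall N le_rfl)
  obtain ⟨k₀, hk₀, hck₀⟩ := hex
  have hdom : ∃ k, ¬ cond (body^[k] s) := ⟨k₀, hck₀⟩
  refine ⟨body^[Nat.find hdom] s, ⟨hdom, ?_⟩, Nat.find hdom, (Nat.find_min' hdom hck₀).trans hk₀,
    hP _ fun i hi => not_not.1 (Nat.find_min hdom hi), Nat.find_spec hdom⟩
  simp only [whileLoop]

/-- A fold of `ConserveMass` type that sets the coordinates in a list one after the other. -/
theorem exists_mem_foldlM_update {good : Fin n → ℝ → Prop} {M : ℕ}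
    {f : Output n → Fin n → Part SearchState}
    (hf : ∀ out y, ∃ s ∈ f out y, good y s.lower ∧ s.queries ≤ out.queries + M)
    (l : List (Fin n)) (out : Output n) :
    ∃ out' ∈ l.foldlM (fun (out : Output n) (y : Fin n) => (f out y).map fun s =>
        ({ strategy := Function.update out.strategy y s.lower, queries := s.queries } : Output n))
        out,
      out'.queries ≤ out.queries + l.length * M ∧
      ∀ y, (y ∈ l ∨ good y (out.strategy y)) → good y (out'.strategy y) := by
  induction l generalizing out with
  | nil => exact ⟨out, by simp, by simp, by simp⟩
  | cons y l ih =>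
    obtain ⟨s, hs, hgood, hq⟩ := hf out y
    obtain ⟨out', hout', hq', hgood'⟩ :=
      ih { strategy := Function.update out.strategy y s.lower, queries := s.queries }
    refine ⟨out', ?_, ?_, fun z hz => hgood' z ?_⟩
    · rw [List.foldlM_cons]
      exact Part.mem_bind_iff.2 ⟨_, Part.mem_map _ hs, hout'⟩
    · simp only [List.length_cons] at hq' ⊢
      linarith
    · rcases eq_or_ne z y with rfl | hzy
      · right; simpa using hgood
      · rcases hz with hz | hz
        · left; simpa [hzy] using hz
        · right; simpa [hzy] using hz

end Clinch

/-! ### Analysis of the binary searches and of the main loop -/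

namespace SecurityGame

variable {G : SecurityGame n} {c d : Fin n → ℝ} {w lam κ : ℝ}
  {oracle : ℕ → (Fin n → ℝ) → Fin n}

open Clinch

/-- One binary search of `ConserveMass`. -/
theorem exists_mem_search (h : G.IsAffine c d) (hw : G.IsMinLevel c d w)
    (horacle : G.IsBestResponseOracle oracle) {x lo : Fin n → ℝ} (hx : x ∈ G.X) (hlo : 0 ≤ lo)
    (hlox : lo ≤ x) (hlow : lo ≤ levelStrategy c d w) {w₀ : ℝ}
    (hw₀ : ∀ y, d y - c y * x y ≤ w₀) {M : ℕ} (hM : (1 / 2) ^ M < lam) (y : Fin n) (q : ℕ) :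
    ∃ s ∈ whileLoop (fun s : SearchState => lam ≤ s.upper - s.lower) (searchStep oracle x y)
        { lower := lo y, upper := x y, queries := q },
      (0 ≤ s.lower ∧ levelStrategy c d w₀ y - lam ≤ s.lower ∧
        s.lower ≤ levelStrategy c d w y) ∧ s.queries ≤ q + M := by
  have hlo0 : ∀ y, 0 ≤ lo y := hlo
  obtain ⟨s, hs, k, hk, hP, hcond⟩ := exists_mem_whileLoop (N := M)
    (cond := fun s : SearchState => lam ≤ s.upper - s.lower) (body := searchStep oracle x y)
    (s := { lower := lo y, upper := x y, queries := q })
    (fun k s => 0 ≤ s.lower ∧ s.lower ≤ s.upper ∧ s.upper ≤ x y ∧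
      s.upper - s.lower ≤ (1 / 2) ^ k ∧ s.queries = q + k ∧
      s.lower ≤ levelStrategy c d w y ∧ levelStrategy c d w₀ y ≤ s.upper)
    ⟨hlo0 y, hlox y, le_rfl, by have := (coord_mem hx y).2; have := hlo0 y; simp; linarith,
      rfl, hlow y, (h.levelStrategy_le_iff (coord_mem hx y).1).2 (hw₀ y)⟩
    (by
      rintro k ⟨l, u, q'⟩ ⟨h0, hlu, hux, hlen, hq, hlw, hwu⟩ -
      simp only at *
      set m := (u + l) / 2 with hm
      have hz : x + Pi.single y (m - x y) ∈ G.X := by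
        refine G.downward_closed _ hx _ (fun j => ?_) fun j => ?_
        · rcases eq_or_ne j y with rfl | hj
          · simp [hm]; linarith
          · simpa [hj] using (coord_mem hx j).1
        · rcases eq_or_ne j y with rfl | hj
          · simp [hm]; linarith
          · simp [hj]
      have hbr := horacle q' _ hz
      have hzy : (x + Pi.single y (m - x y) : Fin n → ℝ) y = m := by simp
      have hpow : (1 / 2 : ℝ) ^ (k + 1) = (1 / 2) ^ k / 2 := by ring
      rw [hpow]
      unfold searchStep
      simp only [← hm]
      split_ifs with hy
      -- Answer `y`: a best response is covered at most as in the optimum, so `m` is a valid lower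
      -- bound.
      · rw [hy] at hbr
        have := hw.coord_le h hz hbr
        rw [hzy] at this
        exact ⟨by simp only [hm]; linarith, by simp only [hm]; linarith, hux,
          by simp only [hm]; linarith, by simp only [hq]; ring, this, hwu⟩
      · refine ⟨h0, by simp only [hm]; linarith, by simp only [hm]; linarith,
          by simp only [hm]; linarith, by simp only [hq]; ring, hlw, ?_⟩
        -- Another answer: at coverage `m`, target `y` pays at most as much as the answered target,
        -- whose coverage is unchanged and whose payoff is at most `w₀`.
        refine (h.levelStrategy_le_iff (by simp only [hm]; linarith)).2 ?_
        have h1 := (h.mem_bestResponses_iff hz).1 hbr y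
        rw [hzy] at h1
        refine h1.trans (le_trans (le_of_eq ?_) (hw₀ (oracle q' (x + Pi.single y (m - x y)))))
        simp [hy])
    (by
      rintro s ⟨-, -, -, hlen, -⟩ hcond
      linarith)
  obtain ⟨h0, -, -, -, hq, hlw, hwu⟩ := hP
  simp only [not_le] at hcond
  exact ⟨s, hs, ⟨h0, by linarith, hlw⟩, by omega⟩

/-- `ConserveMass` approximates the strategy of minimal level from below. -/
theorem exists_mem_conserveMass (h : G.IsAffine c d) (hw : G.IsMinLevel c d w)
    (horacle : G.IsBestResponseOracle oracle) {x lo : Fin n → ℝ} (hx : x ∈ G.X) (hlo : 0 ≤ lo)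
    (hlox : lo ≤ x) (hlow : lo ≤ levelStrategy c d w) {w₀ : ℝ}
    (hw₀ : ∀ y, d y - c y * x y ≤ w₀) {M : ℕ} (hM : (1 / 2) ^ M < lam) (k : ℕ) :
    ∃ out ∈ conserveMass oracle lam lo x k, out.queries ≤ k + n * M ∧
      ∀ y, 0 ≤ out.strategy y ∧ levelStrategy c d w₀ y - lam ≤ out.strategy y ∧
        out.strategy y ≤ levelStrategy c d w y := by
  obtain ⟨out, hout, hq, hgood⟩ := exists_mem_foldlM_update
    (good := fun y t => 0 ≤ t ∧ levelStrategy c d w₀ y - lam ≤ t ∧ t ≤ levelStrategy c d w y)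
    (f := fun out y => whileLoop (fun s : SearchState => lam ≤ s.upper - s.lower)
      (searchStep oracle x y) { lower := lo y, upper := x y, queries := out.queries })
    (fun out y => exists_mem_search h hw horacle hx hlo hlox hlow hw₀ hM y out.queries)
    (List.finRange n) { strategy := x, queries := k }
  exact ⟨out, hout, by simpa using hq, fun y => hgood y (Or.inl (List.mem_finRange y))⟩

/-- The invariant of the main loop of `Clinch`. -/
structure MainInvariant (G : SecurityGame n) (xs : Fin n → ℝ) (lam : ℝ) (s : State n) : Prop where
  nonneg : 0 ≤ s.lo
  le : s.lo ≤ xs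
  up_active : ∀ j ∈ s.active, s.up j = 1
  up_inactive : ∀ j, j ∉ s.active → s.up j = s.lo j
  S_eq : ∃ lo₀ ≤ s.lo, s.S = {z | z ∈ G.X ∧ lo₀ ≤ z ∧ z ≤ s.up}
  lt_inactive : ∀ j, j ∉ s.active → xs j < s.lo j + lam
  extent : ∀ j ∈ s.active, s.lo + Pi.single j (lam / 2 * (1 / 2) ^ n) ∈ G.X

/-- What the last query of the main loop tells. -/
structure LastQuery (G : SecurityGame n) (s : State n) : Prop where
  mem : s.x ∈ G.X
  le : s.lo ≤ s.x
  y_mem : s.y ∈ G.bestResponses s.x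

/-- The body of the main loop keeps the invariant, and halves the potential if the answer is
active. -/
theorem mainStep_spec (h : G.IsAffine c d) (hw : G.IsMinLevel c d w)
    (horacle : G.IsBestResponseOracle oracle) (hlam : 0 < lam) (hκ : 0 < κ) (hκ1 : κ ≤ 1)
    (hκlam : 2 ^ (n + 1) * κ ≤ lam / 2 * (1 / 2) ^ n / n) {C : ℝ} {s : State n}
    (hs : MainInvariant G (levelStrategy c d w) lam s) :
    MainInvariant G (levelStrategy c d w) lam (mainStep G.X C 0 lam oracle s) ∧
      LastQuery G (mainStep G.X C 0 lam oracle s) ∧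
      ((mainStep G.X C 0 lam oracle s).y ∈ (mainStep G.X C 0 lam oracle s).active →
        volume.real (G.thickened (mainStep G.X C 0 lam oracle s).active κ
          (mainStep G.X C 0 lam oracle s).lo)
          ≤ 1 / 2 * volume.real (G.thickened s.active κ s.lo)) := by
  classical
  set xs := levelStrategy c d w with hxs
  -- `S` is computed before the lower bound is raised, so it may still refer to an older bound
  -- `lo₀`.
  obtain ⟨lo₀, hlo₀, hS⟩ := hs.S_eq
  have hnn : ∀ j, 0 ≤ s.lo j := hs.nonneg
  have hloX : s.lo ∈ G.X := G.downward_closed _ hw.mem _ hs.nonneg hs.le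
  set η := lam / 2 * (1 / 2) ^ n with hη
  have hη0 : 0 < η := by positivity
  have hηlam : η ≤ lam := by
    have : (1 / 2 : ℝ) ^ n ≤ 1 := pow_le_one₀ (by norm_num) (by norm_num)
    rw [hη]; nlinarith
  have hpow : (1 : ℝ) ≤ 2 ^ (n + 1) := one_le_pow₀ (by norm_num)
  have hκlam' : κ ≤ lam / n := by
    have h1 : κ ≤ 2 ^ (n + 1) * κ := le_mul_of_one_le_left hκ.le hpow
    exact h1.trans (hκlam.trans (by gcongr))
  set A' : Set (Fin n) := s.active \ {z | s.lo + Pi.single z lam ∉ s.S} with hA'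
  have hA'mem : ∀ j, j ∈ A' ↔ j ∈ s.active ∧ s.lo + Pi.single j lam ∈ s.S := by
    intro j; simp [hA']
  have hext : ∀ j ∈ A', s.lo + Pi.single j lam ∈ G.X := by
    intro j hj
    have := ((hA'mem j).1 hj).2
    rw [hS] at this
    exact this.1
  have hlt : ∀ j, j ∉ A' → xs j < s.lo j + lam := by
    intro j hj
    by_cases hja : j ∈ s.active
    · by_contra! hle
      refine hj ((hA'mem j).2 ⟨hja, ?_⟩)
      have hsingle : (0 : Fin n → ℝ) ≤ Pi.single j lam := by simpa using hlam.le
      have hmem : s.lo + Pi.single j lam ∈ G.X := by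
        refine G.downward_closed _ hw.mem _ (add_nonneg hs.nonneg hsingle) fun k => ?_
        rcases eq_or_ne k j with rfl | hk
        · simpa using hle
        · simpa [hk] using hs.le k
      rw [hS]
      refine ⟨hmem, hlo₀.trans (le_add_of_nonneg_right hsingle), fun k => ?_⟩
      by_cases hka : k ∈ s.active
      · rw [hs.up_active k hka]
        exact (coord_mem hmem k).2
      · have hkj : k ≠ j := fun h => hka (h ▸ hja)
        simp [hs.up_inactive k hka, hkj]
    · exact hs.lt_inactive j hja
  set up' : Fin n → ℝ := fun j => if s.lo + Pi.single j lam ∈ s.S then s.up j else s.lo j with hup'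
  have hup1 : ∀ j ∈ A', up' j = 1 := by
    intro j hj
    obtain ⟨h1, h2⟩ := (hA'mem j).1 hj
    simp only [hup', if_pos h2, hs.up_active j h1]
  have hup0 : ∀ j, j ∉ A' → up' j = s.lo j := by
    intro j hj
    simp only [hup']
    split_ifs with hin
    · exact hs.up_inactive j fun hja => hj ((hA'mem j).2 ⟨hja, hin⟩)
    · rfl
  have hface : {z | z ∈ G.X ∧ s.lo ≤ z ∧ z ≤ up'} = G.face A' s.lo := by
    ext z
    constructor
    · rintro ⟨hz, hlo, hup⟩
      exact ⟨hz, hlo, fun j hj => le_antisymm (hup0 j hj ▸ hup j) (hlo j)⟩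
    · rintro ⟨hz, hlo, heq⟩
      refine ⟨hz, hlo, fun j => ?_⟩
      by_cases hj : j ∈ A'
      · rw [hup1 j hj]; exact (coord_mem hz j).2
      · rw [hup0 j hj, heq j hj]
  have hvol : 0 < volume.real (G.thickened A' κ s.lo) :=
    (pow_pos hκ n).trans_le (pow_le_volume_thickened hs.nonneg hloX hκ.le hκ1 hκlam' hext)
  obtain ⟨hxface, hxmean⟩ := centroid_face hs.nonneg hlam hloX hext hvol
  set x' := centroid (G.face A' s.lo) with hx'
  set y' := oracle s.queries x' with hy'
  have hbr : y' ∈ G.bestResponses x' := horacle _ _ hxface.1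
  have hstep : mainStep G.X C 0 lam oracle s
      = { lo := Function.update s.lo y' (x' y'), up := up', S := G.face A' s.lo, active := A',
          x := x', y := y', queries := s.queries + 1 } := by
    simp only [mainStep]
    rw [← hup', hface, ← hA', ← hx', ← hy', mul_zero, sub_zero]
  rw [hstep]
  set lo' := Function.update s.lo y' (x' y') with hlo'
  have hlolo' : s.lo ≤ lo' := by
    rw [hlo', le_update_iff]; exact ⟨hxface.2.1 y', fun _ _ => le_rfl⟩
  have hlo'x : lo' ≤ x' := by
    rw [hlo', update_le_iff]; exact ⟨le_rfl, fun j _ => hxface.2.1 j⟩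
  have hlo'xs : lo' ≤ xs := by
    rw [hlo', update_le_iff]; exact ⟨hw.coord_le h hxface.1 hbr, fun j _ => hs.le j⟩
  have hlo'0 : 0 ≤ lo' := hs.nonneg.trans hlolo'
  have hoff : ∀ j, j ∉ A' → lo' j = s.lo j := by
    intro j hj
    rcases eq_or_ne j y' with rfl | hjy
    · simp [hlo', hxface.2.2 _ hj]
    · simp [hlo', hjy]
  have hlo'mean : ∀ hy : y' ∈ A',
      lo' = Function.update s.lo y' (s.lo y' + G.thickenedMean A' κ s.lo y') := by
    intro hy; rw [hlo', hxmean y' hy]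
  refine ⟨⟨hlo'0, hlo'xs, hup1, fun j hj => ?_, ⟨s.lo, hlolo', hface.symm⟩, fun j hj => ?_,
    fun j hj => ?_⟩, ⟨hxface.1, hlo'x, hbr⟩, fun hy => ?_⟩
  · exact (hup0 j hj).trans (hoff j hj).symm
  · exact (hlt j hj).trans_le (by have := hlolo' j; simp only; linarith)
  · have hsingle : (0 : Fin n → ℝ) ≤ Pi.single j η := by simpa using hη0.le
    have hj' : j ∈ A' := hj
    -- For the raised coordinate the room lies above the mean; for the others the centroid itself
    -- already lies `η` above the bound.
    by_cases hjy : j = y'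
    · subst hjy
      have := add_single_thickenedMean_mem hs.nonneg hlam.le hκ.le hκ1 hvol hj' hloX (hext _ hj')
      refine G.downward_closed _ this _ (add_nonneg hlo'0 hsingle) fun k => ?_
      rw [hlo'mean hj']
      rcases eq_or_ne k y' with rfl | hk
      · simp; linarith
      · simp [hk]
    · refine G.downward_closed _ hxface.1 _ (add_nonneg hlo'0 hsingle) fun k => ?_
      rcases eq_or_ne k j with rfl | hk
      · rw [hxmean k hj']
        have := le_thickenedMean hs.nonneg hlam.le hκ.le hκ1 hvol hj' (hext _ hj')
        simp only [Pi.add_apply, Pi.single_eq_same, hlo', Function.update_of_ne hjy]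
        linarith
      · simpa [hk] using hlo'x k
  · have hy'A : y' ∈ A' := hy
    have hmean := le_thickenedMean hs.nonneg hlam.le hκ.le hκ1 hvol hy'A (hext _ hy'A)
    have h1 := volume_thickened_update_le_half hs.nonneg hκ1 hy'A hvol (hη0.trans_le hmean)
    -- Locking comes before the cut, so only the weaker extent `η` from the invariant is available
    -- here; the surviving coordinates have extent `lam`.
    have h2 := volume_thickened_anti (A' := A') hs.nonneg hloX hη0.le hκ1 hκlam hs.extent
      (fun j hj => ((hA'mem j).1 hj).1)
    simp only
    rw [hlo'mean hy'A]
    linarith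

/-- Bit precision makes the game full-dimensional. -/
theorem BitPrecise.single_mem [NeZero n] {L : ℕ} (hG : G.BitPrecise L) {t : ℝ} (ht : 0 ≤ t)
    (htL : t < ((2 : ℝ) ^ (n * L))⁻¹) (j : Fin n) : Pi.single j t ∈ G.X := by
  by_contra hnot
  obtain ⟨x₀, hx₀⟩ := G.nonempty
  obtain ⟨y, hy⟩ := G.bestResponses_nonempty x₀
  have hvol := hG.volume_region y ⟨x₀, hx₀, hy⟩
  have hlt : ∀ x ∈ G.X, x j ≤ t := by
    intro x hx
    by_contra! hlt
    refine hnot (G.downward_closed x hx _ (by simpa using ht) fun k => ?_)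
    rcases eq_or_ne k j with rfl | hk
    · simpa using hlt.le
    · simpa [hk] using (coord_mem hx k).1
  have hsub : G.region y ⊆ Set.Icc 0 (Function.update 1 j t) := by
    rintro x ⟨hx, -⟩
    -- If coordinate `j` never exceeded `t`, every region would lie in a slab of volume `t`, too
    -- thin for the volume assumption.
    refine ⟨(G.subset_cube hx).1, ?_⟩
    rw [le_update_iff]
    exact ⟨hlt x hx, fun k _ => (G.subset_cube hx).2 k⟩
  have hle := hvol.trans (measure_mono hsub)
  have hv : volume (Set.Icc (0 : Fin n → ℝ) (Function.update 1 j t)) = ENNReal.ofReal t := by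
    rw [Real.volume_Icc_pi, Finset.prod_eq_single j]
    · simp
    · intro k _ hk; simp [hk]
    · simp
  rw [hv, ENNReal.ofReal_le_ofReal_iff ht] at hle
  linarith

/-- The main loop terminates. -/
theorem exists_mem_mainLoop [NeZero n] (h : G.IsAffine c d) (hw : G.IsMinLevel c d w)
    (horacle : G.IsBestResponseOracle oracle) (hlam : 0 < lam) (hκ : 0 < κ) (hκ1 : κ ≤ 1)
    (hκlam : 2 ^ (n + 1) * κ ≤ lam / 2 * (1 / 2) ^ n / n)
    (hsingle : ∀ j, Pi.single j (lam / 2 * (1 / 2) ^ n) ∈ G.X) (C : ℝ) {N : ℕ}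
    (hN : (1 / 2) ^ N < κ ^ n) :
    ∃ s ∈ whileLoop (fun s : State n => s.y ∈ s.active) (mainStep G.X C 0 lam oracle)
        { lo := 0, up := 1, S := G.X, active := Set.univ, x := 0, y := 0, queries := 0 },
      s.queries ≤ N ∧ MainInvariant G (levelStrategy c d w) lam s ∧ LastQuery G s ∧
        s.y ∉ s.active := by
  have hpow : (1 : ℝ) ≤ 2 ^ (n + 1) := one_le_pow₀ (by norm_num)
  have hκ' : κ ≤ lam / 2 * (1 / 2) ^ n / n :=
    (le_mul_of_one_le_left hκ.le hpow).trans hκlam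
  obtain ⟨s, hs, k, hk, ⟨hinv, hlast, hq, -⟩, hcond⟩ := exists_mem_whileLoop (N := N)
    (cond := fun s : State n => s.y ∈ s.active) (body := mainStep G.X C 0 lam oracle)
    (s := { lo := 0, up := 1, S := G.X, active := Set.univ, x := 0, y := 0, queries := 0 })
    -- `LastQuery` is conditional because the initial `x` and `y` are defaults that answer no query;
    -- initially every target is active, so nothing is claimed.
    (fun k s => MainInvariant G (levelStrategy c d w) lam s ∧
      (s.y ∉ s.active → LastQuery G s) ∧ s.queries = k ∧
      (s.y ∈ s.active → volume.real (G.thickened s.active κ s.lo) ≤ (1 / 2) ^ k))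
    (by
      refine ⟨⟨le_rfl, levelStrategy_nonneg c d w, fun _ _ => rfl, ?_, ⟨0, le_rfl, ?_⟩, ?_, ?_⟩,
        ?_, rfl, ?_⟩
      · simp
      · ext z
        exact ⟨fun hz => ⟨hz, (G.subset_cube hz).1, (G.subset_cube hz).2⟩, fun hz => hz.1⟩
      · simp
      · intro j _; simpa using hsingle j
      · simp
      · intro _
        refine (measureReal_mono (thickened_subset_cube le_rfl hκ1)
          isCompact_Icc.measure_lt_top.ne).trans ?_
        simp [Measure.real, Real.volume_Icc_pi])
    (by
      rintro k s ⟨hinv, -, hq, hvol⟩ hcond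
      obtain ⟨h1, h2, h3⟩ := mainStep_spec (C := C) h hw horacle hlam hκ hκ1 hκlam hinv
      refine ⟨h1, fun _ => h2, ?_, fun hy => ?_⟩
      · simp [mainStep, hq]
      · refine (h3 hy).trans ?_
        rw [pow_succ']
        exact mul_le_mul_of_nonneg_left (hvol hcond) (by norm_num))
    (by
      rintro s ⟨hinv, -, -, hvol⟩ hcond
      have hloX : s.lo ∈ G.X := G.downward_closed _ hw.mem _ hinv.nonneg hinv.le
      have := pow_le_volume_thickened hinv.nonneg hloX hκ.le hκ1 hκ' hinv.extent
      have := hvol hcond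
      linarith)
  exact ⟨s, hs, by omega, hinv, hlast hcond, hcond⟩

/-- `Clinch` with exact oracle and trivial initial bounds, in terms of its accuracy. -/
theorem exists_mem_clinch [NeZero n] (h : G.IsAffine c d) (hw : G.IsMinLevel c d w)
    (horacle : G.IsBestResponseOracle oracle) {C δ : ℝ} (hC1 : 1 ≤ C) (hC : ∀ y, 1 ≤ C * c y)
    (hδ : 0 < δ) (hlam : δ / (4 * C ^ 2) = lam) (hκ : 0 < κ) (hκ1 : κ ≤ 1)
    (hκlam : 2 ^ (n + 1) * κ ≤ lam / 2 * (1 / 2) ^ n / n)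
    (hsingle : ∀ j, Pi.single j (lam / 2 * (1 / 2) ^ n) ∈ G.X) {N M : ℕ}
    (hN : (1 / 2) ^ N < κ ^ n) (hM : (1 / 2) ^ M < lam) :
    ∃ out ∈ clinch G.X C 0 δ 0 1 oracle, out.queries ≤ N + n * M ∧ out.strategy ∈ G.X ∧
      ∀ y, |out.strategy y - levelStrategy c d w y| ≤ δ := by
  have hlam0 : 0 < lam := hlam ▸ by positivity
  obtain ⟨s, hs, hq, hinv, hlast, hy⟩ :=
    exists_mem_mainLoop h hw horacle hlam0 hκ hκ1 hκlam hsingle C hN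
  set w₀ := d s.y - c s.y * s.x s.y with hw₀
  obtain ⟨out, hout, hq', hstrat⟩ := exists_mem_conserveMass h hw horacle hlast.mem hinv.nonneg
    hlast.le hinv.le ((h.mem_bestResponses_iff hlast.mem).1 hlast.y_mem) hM s.queries
  refine ⟨out, ?_, by omega, ?_, fun y => ?_⟩
  · simp only [clinch, hlam]
    exact Part.mem_bind_iff.2 ⟨s, hs, hout⟩
  · exact G.downward_closed _ hw.mem _ (fun y => (hstrat y).1) fun y => (hstrat y).2.2
  · have hww : w₀ ≤ w + lam := by
      have h1 := hinv.lt_inactive s.y hy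
      have h2 := hlast.le s.y
      have h3 := h.payoff_levelStrategy_le w s.y
      have h4 := h.pos s.y
      have h5 := h.le_one s.y
      have h6 : c s.y * (levelStrategy c d w s.y - s.x s.y) ≤ 1 * lam :=
        (mul_le_mul_of_nonneg_left (by linarith) h4.le).trans
          (mul_le_mul_of_nonneg_right h5 hlam0.le)
      rw [hw₀]
      linarith
    have h1 := h.levelStrategy_le_add hww hlam0.le hC y
    obtain ⟨-, h2, h3⟩ := hstrat y
    -- The total error is `C * lam` from the level plus `lam` from the search, and `C + 1 ≤ 4 * C ^
    -- 2`.
    have h4 : (C + 1) * lam ≤ δ := by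
      rw [← hlam, ← mul_div_assoc, div_le_iff₀ (by positivity), mul_comm]
      exact mul_le_mul_of_nonneg_left (by nlinarith) hδ.le
    rw [← hw₀] at h2
    rw [abs_le]
    constructor <;> linarith

end SecurityGame

end

/-! ### Choice of the parameters -/

theorem mainTheorem12 :
    ∃ K : ℕ, ∀ (n L : ℕ) [NeZero n], 1 ≤ L →
      ∀ G : SecurityGame n, G.BitPrecise L →
        ∃ xstar : Fin n → ℝ, (∀ x, G.IsConservativeOptimum x ↔ x = xstar) ∧
          ∀ oracle : ℕ → (Fin n → ℝ) → Fin n, G.IsBestResponseOracle oracle →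
            ∃ out ∈ Clinch.clinch G.X ((2 : ℝ) ^ L) 0 (1 / 3 * ((2 : ℝ) ^ (8 * L * n))⁻¹) 0 1 oracle,
              out.queries ≤ K * n ^ 2 * L ∧
              out.strategy ∈ G.X ∧
              ‖out.strategy - xstar‖ ≤ 1 / 3 * ((2 : ℝ) ^ (8 * L * n))⁻¹ ∧
              (∀ y, Clinch.nearestPoints (Clinch.fractions (2 ^ (4 * L * n)))
                (out.strategy y) = {xstar y}) ∧
              (∀ y, xstar y ∈ Clinch.multiples (((2 : ℝ) ^ (8 * L * n))⁻¹) →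
                Clinch.nearestPoints (Clinch.multiples (((2 : ℝ) ^ (8 * L * n))⁻¹))
                  (out.strategy y) = {xstar y}) := by
  refine ⟨35, fun n L _ hL G hG => ?_⟩
  have hn : 1 ≤ n := Nat.one_le_iff_ne_zero.2 (NeZero.ne n)
  have hLn : L ≤ L * n := Nat.le_mul_of_pos_right L hn
  have hnL : n ≤ L * n := Nat.le_mul_of_pos_left n hL
  obtain ⟨c, d, m, a, b, h, hc, hd, hab, hX⟩ := hG.exists_data
  obtain ⟨w, hw⟩ := h.exists_isMinLevel
  set xs := SecurityGame.levelStrategy (fun y => (c y : ℝ)) (fun y => (d y : ℝ)) w with hxs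
  refine ⟨xs, fun x => hw.isConservativeOptimum_iff h, fun oracle horacle => ?_⟩
  set e : ℝ := ((2 : ℝ) ^ (8 * L * n))⁻¹ with he
  have he0 : 0 < e := by positivity
  -- A positive rational is at least the reciprocal of its denominator.
  have hC : ∀ y, (1 : ℝ) ≤ 2 ^ L * (c y : ℝ) := by
    intro y
    have hpos : 0 < c y := by exact_mod_cast h.pos y
    have h1 : (1 : ℚ) ≤ (c y).den * c y := by
      rw [Rat.den_mul_eq_num]
      exact_mod_cast Rat.num_pos.2 hpos
    have h2 : ((c y).den : ℚ) ≤ 2 ^ L := by exact_mod_cast (hc y).2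
    have h3 : (1 : ℚ) ≤ 2 ^ L * c y := h1.trans (mul_le_mul_of_nonneg_right h2 hpos.le)
    exact_mod_cast h3
  set lam : ℝ := 1 / 3 * e / (4 * (2 ^ L) ^ 2) with hlam
  have hlam_eq : lam = 1 / 12 * (1 / 2) ^ (8 * (L * n) + 2 * L) := by
    rw [hlam, he, pow_add, one_div_pow, one_div_pow, pow_mul' 2 2 L,
      show 8 * L * n = 8 * (L * n) by ring]
    field_simp
    norm_num
  have hlam0 : 0 < lam := by positivity
  have hlamM : (1 / 2 : ℝ) ^ (8 * (L * n) + 2 * L + 4) < lam := by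
    rw [hlam_eq, pow_add _ _ 4]
    have : (0 : ℝ) < (1 / 2) ^ (8 * (L * n) + 2 * L) := by positivity
    linarith
  -- The exponent must cover `8 * L * n + 2 * L + 4` for `lam` and `3 * n + 2` for the remaining
  -- factors; `8 + 2 + 4 + 3 + 2 = 19`.
  set κ : ℝ := (1 / 2) ^ (19 * (L * n)) with hκ
  have hκlam : 2 ^ (n + 1) * κ ≤ lam / 2 * (1 / 2) ^ n / n := by
    have hn2 : (n : ℝ) ≤ 2 ^ n := by exact_mod_cast Nat.lt_two_pow_self.le
    have hn0 : (0 : ℝ) < n := by exact_mod_cast hn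
    rw [le_div_iff₀ hn0]
    have h1 : κ ≤ (1 / 2) ^ (8 * (L * n) + 2 * L + 4 + (n + 1 + n + 1 + n)) :=
      pow_le_pow_of_le_one (by norm_num) (by norm_num) (by omega)
    have hcancel : ∀ k : ℕ, (2 : ℝ) ^ k * (1 / 2) ^ k = 1 := fun k => by
      rw [← mul_pow]; norm_num
    calc 2 ^ (n + 1) * κ * n
        ≤ 2 ^ (n + 1) * (1 / 2) ^ (8 * (L * n) + 2 * L + 4 + (n + 1 + n + 1 + n)) * 2 ^ n := by
          gcongr
      _ = (1 / 2) ^ (8 * (L * n) + 2 * L + 4) / 2 * (1 / 2) ^ n *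
          (2 ^ (n + 1) * (1 / 2) ^ (n + 1)) * (2 ^ n * (1 / 2) ^ n) := by
          rw [pow_add (1 / 2 : ℝ) (8 * (L * n) + 2 * L + 4)]
          ring
      _ = (1 / 2) ^ (8 * (L * n) + 2 * L + 4) / 2 * (1 / 2) ^ n := by
          rw [hcancel, hcancel]; ring
      _ ≤ lam / 2 * (1 / 2) ^ n := by gcongr
  have hsingle : ∀ j, Pi.single j (lam / 2 * (1 / 2) ^ n) ∈ G.X := by
    refine hG.single_mem (by positivity) ?_
    have h1 : (1 / 2 : ℝ) ^ n ≤ 1 := pow_le_one₀ (by norm_num) (by norm_num)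
    have h2 : (1 / 2 : ℝ) ^ (8 * (L * n) + 2 * L) ≤ (1 / 2) ^ (n * L) :=
      pow_le_pow_of_le_one (by norm_num) (by norm_num) (by nlinarith)
    have h3 : ((2 : ℝ) ^ (n * L))⁻¹ = (1 / 2) ^ (n * L) := by rw [one_div_pow, one_div]
    have h4 : (0 : ℝ) < (1 / 2) ^ (n * L) := by positivity
    have h5 : lam / 2 * (1 / 2) ^ n ≤ lam / 2 * 1 := by gcongr
    rw [h3]
    linarith
  have hκN : (1 / 2 : ℝ) ^ (19 * (L * n) * n + 1) < κ ^ n := by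
    rw [hκ, ← pow_mul]
    exact pow_lt_pow_right_of_lt_one₀ (by norm_num) (by norm_num) (Nat.lt_succ_self _)
  obtain ⟨out, hout, hq, hmem, hdist⟩ := SecurityGame.exists_mem_clinch h hw horacle
    (C := 2 ^ L) (δ := 1 / 3 * e) (one_le_pow₀ (by norm_num)) hC (by positivity) hlam.symm
    (by positivity) (pow_le_one₀ (by norm_num) (by norm_num)) hκlam hsingle hκN hlamM
  refine ⟨out, hout, ?_, hmem, ?_, fun y => ?_, fun y hy => ?_⟩
  · have h1 : n * (8 * (L * n) + 2 * L + 4) ≤ n * (14 * (L * n)) :=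
      Nat.mul_le_mul_left _ (by omega)
    have h2 : 1 ≤ L * n * n := Nat.one_le_iff_ne_zero.2 (by positivity)
    calc out.queries ≤ 19 * (L * n) * n + 1 + n * (14 * (L * n)) := by omega
      _ ≤ 19 * (L * n) * n + 2 * (L * n * n) + n * (14 * (L * n)) := by omega
      _ = 35 * n ^ 2 * L := by ring
  · exact (pi_norm_le_iff_of_nonneg (by positivity)).2 hdist
  · refine Clinch.nearestPoints_eq_singleton
      (SecurityGame.BitPrecise.levelStrategy_mem_fractions hL h hc hd hab hX hw y) he0
      (fun r hr hne => ?_) (hdist y)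
    refine le_trans (le_of_eq ?_) (Clinch.fractions_separated hr
      (SecurityGame.BitPrecise.levelStrategy_mem_fractions hL h hc hd hab hX hw y) hne)
    rw [he]
    push_cast
    rw [← pow_mul]
    congr 2
    ring
  · exact Clinch.nearestPoints_eq_singleton hy he0
      (fun r hr hne => Clinch.multiples_separated he0 hr hy hne) (hdist y)
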